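/- For $n,k\ge 1$ let $H_{n,k}$ be the space of real homogeneous polynomials of degree $k$ in $x_0,\dots,x_n$, with the Bombieri–Weyl inner product, for which the scaled monomials $\sqrt{k!/(\alpha_0!\cdots\alpha_n!)}\,x^\alpha$ form an orthonormal basis. Let $\widehat{\mathbb V}_{n,k}=\{\pm\ell^k\mid \ell \text{ a real linear form}\}$ and let $\mathbb V_{n,k}$ be its intersection with the unit sphere. Let $\mathbf n=(n_1,\dots,n_r)$ and $\mathbf d=(d_1,\dots,d_r)$ be tuples of positive integers with $d:=d_1+\cdots+d_r\ge 2$, give $H_{n_1,d_1}\otimes\cdots\otimes H_{n_r,d_r}$ the inner product for which the tensor products of scaled monomials are orthonormal, and let $\mathbb X=\mathbb X_{\mathbf n,\mathbf d}$ be the set of unit-norm tensors $f_1\otimes\cdots\otimes f_r$ with $f_i\in\widehat{\mathbb V}_{n_i,d_i}$ (the spherical Segre–Veronese manifold). For a smooth unit-speed curve $\gamma:\mathbb R\to\mathbb X$, its curvature in the sphere at time $t$ is understood as $\|P_{\gamma(t)}(\gamma''(t))\|$, where $P_x$ is the orthogonal projection onto the normal space of $\mathbb X$ at $x$ inside the tangent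 space of the unit sphere at $x$. (For a geodesic of $\mathbb X$ this is its curvature as a curve in the sphere, $\|\gamma''(t)+\gamma(t)\|$; for other curves it is the normal curvature.) A unit-speed geodesic of $\mathbb X$ or of $\mathbb V_{n,k}$ is a smooth unit-speed curve in it whose second derivative is everywhere orthogonal to its tangent space. 1. The maximum of the curvatures of all unit-speed geodesics of $\mathbb X$, at all times, is $\sqrt{2(d-1)/d}$, and this number bounds the curvature of every smooth unit-speed curve in $\mathbb X$ from above. If $\gamma_i:\mathbb R\to\mathbb V_{n_i,d_i}$ are smooth curves of constant speed $\|\gamma_i'(t)\|=\sqrt{d_i/d}$ for $i=1,\dots,r$, then $\gamma=\gamma_1\otimes\cdots\otimes\gamma_r$ is a unit-speed curve in $\mathbb X$ of curvature $\sqrt{2(d-1)/d}$ at every time. The $\gamma_i$ can be chosen so that, in addition, $\gamma$ is a geodesic of $\mathbb X$. 2. Let $\ell$ be an index with $d_\ell=\min\{d_1,\dots,d_r\}$. The minimum of the curvatures of all unit-speed geodesics of $\mathbb X$, at all times, is $\sqrt{2(d_\ell-1)/d_\ell}$, and this number bounds the curvature of every smooth unit-speed curve in $\mathbb X$ from below.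 If $\gamma_\ell$ is a unit-speed geodesic of $\mathbb V_{n_\ell,d_\ell}$ and every $\gamma_i$ with $i\ne\ell$ is a constant curve in $\mathbb V_{n_i,d_i}$, then $\gamma=\gamma_1\otimes\cdots\otimes\gamma_r$ is a unit-speed geodesic of $\mathbb X$ of curvature $\sqrt{2(d_\ell-1)/d_\ell}$ at every time. Such curves $\gamma_1,\dots,\gamma_r$ exist. -/

import Mathlib

open scoped ContDiff

noncomputable section

namespace SegreVeronese

/-! ### Inner product making a given basis orthonormal -/

/-- The inner product on a real vector space for which a given finite basis is orthonormal. -/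
@[reducible]
def coreOfBasis {ι V : Type*} [Fintype ι] [AddCommGroup V] [Module ℝ V]
    (b : Module.Basis ι ℝ V) : InnerProductSpace.Core ℝ V where
  inner x y := ∑ i, b.repr x i * b.repr y i
  conj_inner_symm x y := by simp [mul_comm]
  re_inner_nonneg x := by
    simpa using Finset.sum_nonneg fun i _ => mul_self_nonneg (b.repr x i)
  add_left x y z := by simp [add_mul, Finset.sum_add_distrib]
  smul_left x y c := by simp [Finset.mul_sum, mul_assoc]
  definite x hx := by
    have h := (Finset.sum_eq_zero_iff_of_nonneg
      (fun i _ => mul_self_nonneg (b.repr x i))).1 hx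
    exact b.ext_elem fun i => by simpa using h i (Finset.mem_univ i)

/-! ### Homogeneous polynomials with the Bombieri-Weyl inner product -/

/-- The space of real homogeneous polynomials of degree `k` in the `n + 1` variables
`x_0, …, x_n`. -/
def Form (n k : ℕ) : Type :=
  MvPolynomial.homogeneousSubmodule (Fin (n + 1)) ℝ k

instance (n k : ℕ) : AddCommGroup (Form n k) :=
  inferInstanceAs (AddCommGroup (MvPolynomial.homogeneousSubmodule (Fin (n + 1)) ℝ k))

instance (n k : ℕ) : Module ℝ (Form n k) :=
  inferInstanceAs (Module ℝ (MvPolynomial.homogeneousSubmodule (Fin (n + 1)) ℝ k))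

/-- The polynomial underlying a form. -/
def Form.toPoly {n k : ℕ} : Form n k →ₗ[ℝ] MvPolynomial (Fin (n + 1)) ℝ :=
  (MvPolynomial.homogeneousSubmodule (Fin (n + 1)) ℝ k).subtype

/-- Exponent vectors `α = (α_0, …, α_n)` with `α_0 + ⋯ + α_n = k`. -/
abbrev Exponent (n k : ℕ) : Type :=
  {α : Fin (n + 1) →₀ ℕ // α ∈ (Finset.univ : Finset (Fin (n + 1))).finsuppAntidiag k}

lemma Exponent.degree_eq {n k : ℕ} (α : Exponent n k) : α.1.degree = k := by
  have h := (Finset.mem_finsuppAntidiag.1 α.2).1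
  rw [Finsupp.degree_eq_sum]
  exact h

/-- The square root of the multinomial coefficient `k! / (α_0! ⋯ α_n!)`. -/
def weight {n k : ℕ} (α : Exponent n k) : ℝ := √(α.1.multinomial : ℝ)

lemma weight_ne_zero {n k : ℕ} (α : Exponent n k) : weight α ≠ 0 := by
  have h : 0 < α.1.multinomial := by
    rw [Finsupp.multinomial_eq]
    exact Nat.multinomial_pos _ _
  exact (Real.sqrt_pos.2 (by exact_mod_cast h)).ne'

/-- The scaled monomial `m_α = √(k! / (α_0! ⋯ α_n!)) x^α`. -/
def scaledMonomial {n k : ℕ} (α : Exponent n k) : Form n k :=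
  ⟨MvPolynomial.monomial α.1 (weight α), MvPolynomial.isHomogeneous_monomial _ α.degree_eq⟩

/-- Coordinates of a form with respect to the scaled monomials. -/
def Form.coordEquiv (n k : ℕ) : Form n k ≃ₗ[ℝ] (Exponent n k → ℝ) where
  toFun f α := MvPolynomial.coeff α.1 f.toPoly / weight α
  map_add' f g := by
    funext α
    simp [add_div]
  map_smul' c f := by
    funext α
    simp [mul_div_assoc]
  invFun c := ∑ α, c α • scaledMonomial α
  left_inv f := by
    apply Subtype.ext
    change Form.toPoly (∑ α, _) = Form.toPoly f
    ext β
    rw [map_sum, MvPolynomial.coeff_sum]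
    have key : ∀ α : Exponent n k, MvPolynomial.coeff β (Form.toPoly
        ((MvPolynomial.coeff α.1 f.toPoly / weight α) • scaledMonomial α)) =
        if α.1 = β then MvPolynomial.coeff β f.toPoly else 0 := by
      intro α
      rw [map_smul]
      change MvPolynomial.coeff β
        (_ • MvPolynomial.monomial α.1 (weight α)) = _
      rw [MvPolynomial.coeff_smul, MvPolynomial.coeff_monomial]
      split_ifs with h
      · subst h
        simp [div_mul_cancel₀ _ (weight_ne_zero α)]
      · simp
    rw [Finset.sum_congr rfl fun α _ => key α]
    by_cases hβ : β ∈ (Finset.univ : Finset (Fin (n + 1))).finsuppAntidiag k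
    · rw [Finset.sum_eq_single ⟨β, hβ⟩]
      · simp
      · intro α _ hα
        rw [if_neg]
        intro h
        exact hα (Subtype.ext h)
      · simp
    · have h0 : MvPolynomial.coeff β f.toPoly = 0 := by
        by_contra hne
        apply hβ
        have hd := (MvPolynomial.mem_homogeneousSubmodule k f.1).1 f.2 hne
        have hd' : β.degree = k := by
          rw [Finsupp.degree_eq_weight_one (R := ℕ)]
          exact hd
        refine Finset.mem_finsuppAntidiag.2 ⟨?_, Finset.subset_univ _⟩
        rw [← hd', Finsupp.degree_eq_sum]
      simp [h0]
  right_inv c := by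
    funext β
    change MvPolynomial.coeff β.1 (Form.toPoly (∑ α, c α • scaledMonomial α)) / weight β = c β
    rw [map_sum, MvPolynomial.coeff_sum]
    have key : ∀ α : Exponent n k, MvPolynomial.coeff β.1 (Form.toPoly
        (c α • scaledMonomial α)) = if α = β then c β * weight β else 0 := by
      intro α
      rw [map_smul]
      change MvPolynomial.coeff β.1
        (_ • MvPolynomial.monomial α.1 (weight α)) = _
      rw [MvPolynomial.coeff_smul, MvPolynomial.coeff_monomial]
      split_ifs with h h' h'
      · subst h'
        simp
      · exact absurd (Subtype.ext h) h'
      · exact absurd (congrArg Subtype.val h') h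
      · simp
    rw [Finset.sum_congr rfl fun α _ => key α]
    simp [weight_ne_zero]

/-- The basis of `Form n k` formed by the scaled monomials. -/
def Form.basis (n k : ℕ) : Module.Basis (Exponent n k) ℝ (Form n k) :=
  Module.Basis.ofEquivFun (Form.coordEquiv n k)

lemma Form.basis_apply {n k : ℕ} (α : Exponent n k) :
    Form.basis n k α = scaledMonomial α := by
  classical
  rw [Form.basis, Module.Basis.coe_ofEquivFun]
  change ∑ β, (Pi.single α (1 : ℝ) : Exponent n k → ℝ) β • scaledMonomial β = _
  rw [Finset.sum_eq_single α]
  · simp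
  · intro β _ h
    simp [Pi.single_eq_of_ne h]
  · simp

/-- The Bombieri-Weyl norm on forms. -/
instance (n k : ℕ) : NormedAddCommGroup (Form n k) :=
  @InnerProductSpace.Core.toNormedAddCommGroup ℝ _ _ _ _ (coreOfBasis (Form.basis n k))

/-- The Bombieri-Weyl inner product on forms: the scaled monomials are orthonormal. -/
instance (n k : ℕ) : InnerProductSpace ℝ (Form n k) :=
  InnerProductSpace.ofCore (coreOfBasis (Form.basis n k)).toCore

instance (n k : ℕ) : FiniteDimensional ℝ (Form n k) :=
  (Form.basis n k).finiteDimensional_of_finite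

/-! ### Partially symmetric tensors -/

/-- The space `H_{n_1,d_1} ⊗ ⋯ ⊗ H_{n_r,d_r}` of partially symmetric tensors. -/
def PSTensor {r : ℕ} (n d : Fin r → ℕ) : Type :=
  PiTensorProduct ℝ fun i => Form (n i) (d i)

instance {r : ℕ} (n d : Fin r → ℕ) : AddCommGroup (PSTensor n d) :=
  inferInstanceAs (AddCommGroup (PiTensorProduct ℝ fun i => Form (n i) (d i)))

instance {r : ℕ} (n d : Fin r → ℕ) : Module ℝ (PSTensor n d) :=
  inferInstanceAs (Module ℝ (PiTensorProduct ℝ fun i => Form (n i) (d i)))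

/-- The decomposable tensor `f_1 ⊗ ⋯ ⊗ f_r`, as a multilinear map. -/
def tensor {r : ℕ} (n d : Fin r → ℕ) :
    MultilinearMap ℝ (fun i => Form (n i) (d i)) (PSTensor n d) :=
  PiTensorProduct.tprod ℝ

/-- The basis `m_{α_1} ⊗ ⋯ ⊗ m_{α_r}` of the space of partially symmetric tensors. -/
def PSTensor.basis {r : ℕ} (n d : Fin r → ℕ) :
    Module.Basis (∀ i, Exponent (n i) (d i)) ℝ (PSTensor n d) :=
  Basis.piTensorProduct fun i => Form.basis (n i) (d i)

lemma PSTensor.basis_apply {r : ℕ} (n d : Fin r → ℕ) (α : ∀ i, Exponent (n i) (d i)) :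
    PSTensor.basis n d α = tensor n d fun i => scaledMonomial (α i) := by
  simp_rw [← Form.basis_apply]
  exact Basis.piTensorProduct_apply _ _

instance {r : ℕ} (n d : Fin r → ℕ) : NormedAddCommGroup (PSTensor n d) :=
  @InnerProductSpace.Core.toNormedAddCommGroup ℝ _ _ _ _ (coreOfBasis (PSTensor.basis n d))

/-- The inner product on tensors: the basis `m_{α_1} ⊗ ⋯ ⊗ m_{α_r}` is orthonormal. -/
instance {r : ℕ} (n d : Fin r → ℕ) : InnerProductSpace ℝ (PSTensor n d) :=
  InnerProductSpace.ofCore (coreOfBasis (PSTensor.basis n d)).toCore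

instance {r : ℕ} (n d : Fin r → ℕ) : FiniteDimensional ℝ (PSTensor n d) :=
  (PSTensor.basis n d).finiteDimensional_of_finite

/-! ### Veronese and Segre-Veronese manifolds -/

/-- The cone `{± ℓ^k}` over the powers of real linear forms `ℓ`. -/
def veroneseCone (n k : ℕ) : Set (Form n k) :=
  {f | ∃ l : Form n 1, f.toPoly = l.toPoly ^ k ∨ f.toPoly = -(l.toPoly ^ k)}

/-- The spherical Veronese manifold: elements of the cone of unit Bombieri-Weyl norm. -/
def veronese (n k : ℕ) : Set (Form n k) :=
  veroneseCone n k ∩ Metric.sphere 0 1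

/-- The spherical Segre-Veronese manifold: the tensors `f_1 ⊗ ⋯ ⊗ f_r` of unit norm with every
`f_i` in the Veronese cone. -/
def segreVeronese {r : ℕ} (n d : Fin r → ℕ) : Set (PSTensor n d) :=
  {F | ∃ f : ∀ i, Form (n i) (d i), (∀ i, f i ∈ veroneseCone (n i) (d i)) ∧ F = tensor n d f} ∩
    Metric.sphere 0 1

/-! ### Submanifolds of a sphere: tangent space, normal space, geodesics, curvature -/

section Geometry

variable {E : Type*} [NormedAddCommGroup E] [InnerProductSpace ℝ E]

/-- The tangent space at `x` of a submanifold `M` of a Euclidean space: the span of the velocities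
at `x` of the smooth curves in `M` passing through `x`. -/
def tangentSpace (M : Set E) (x : E) : Submodule ℝ E :=
  Submodule.span ℝ
    {v | ∃ c : ℝ → E, ContDiff ℝ ∞ c ∧ (∀ t, c t ∈ M) ∧ c 0 = x ∧ deriv c 0 = v}

/-- The normal space at `x` of a submanifold `M` of the unit sphere, inside the tangent space of
the sphere: the vectors orthogonal both to `x` and to the tangent space of `M` at `x`. -/
def normalSpace (M : Set E) (x : E) : Submodule ℝ E :=
  (tangentSpace M x ⊔ Submodule.span ℝ {x})ᗮ

/-- Smooth curves in `M`. -/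
def IsCurveIn (M : Set E) (γ : ℝ → E) : Prop :=
  ContDiff ℝ ∞ γ ∧ ∀ t, γ t ∈ M

/-- Smooth curves in `M` parametrized by arc length. -/
def IsUnitSpeedCurve (M : Set E) (γ : ℝ → E) : Prop :=
  IsCurveIn M γ ∧ ∀ t, ‖deriv γ t‖ = 1

/-- Geodesics of the submanifold `M` parametrized by arc length: smooth unit-speed curves in `M`
whose covariant acceleration, the tangential component of the second derivative, vanishes. -/
def IsUnitSpeedGeodesic (M : Set E) (γ : ℝ → E) : Prop :=
  IsUnitSpeedCurve M γ ∧ ∀ t, deriv (deriv γ) t ∈ (tangentSpace M (γ t))ᗮ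

/-- The curvature at time `t` of a unit-speed curve `γ` in a submanifold `M` of the unit sphere:
the norm of the projection of the second derivative to the normal space of `M` in the sphere.
For a geodesic of `M` this is the full curvature of `γ` as a curve in the sphere, see
`curvature_of_isUnitSpeedGeodesic`; for other curves it is the normal curvature. -/
def curvature [FiniteDimensional ℝ E] (M : Set E) (γ : ℝ → E) (t : ℝ) : ℝ :=
  ‖(normalSpace M (γ t)).starProjection (deriv (deriv γ) t)‖

/-- The set of all curvatures of unit-speed geodesics of `M`, at all times. -/
def geodesicCurvatures [FiniteDimensional ℝ E] (M : Set E) : Set ℝ :=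
  {κ | ∃ γ : ℝ → E, IsUnitSpeedGeodesic M γ ∧ ∃ t : ℝ, curvature M γ t = κ}

lemma curvature_of_isUnitSpeedGeodesic [FiniteDimensional ℝ E] {M : Set E}
    (hM : M ⊆ Metric.sphere 0 1) {γ : ℝ → E} (hγ : IsUnitSpeedGeodesic M γ) (t : ℝ) :
    curvature M γ t = ‖deriv (deriv γ) t + γ t‖ := by
  obtain ⟨⟨⟨hs, hin⟩, hu⟩, hacc⟩ := hγ
  have hγd : Differentiable ℝ γ := hs.differentiable (by simp)
  have hγ'd : Differentiable ℝ (deriv γ) :=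
    ((contDiff_infty_iff_deriv.1 hs).2).differentiable (by simp)
  have hone : ∀ s, inner ℝ (γ s) (γ s) = (1 : ℝ) := fun s => by
    have := hM (hin s)
    rw [mem_sphere_zero_iff_norm] at this
    simp [this]
  have horth : ∀ s, inner ℝ (γ s) (deriv γ s) = (0 : ℝ) := fun s => by
    have h := ((hγd s).hasDerivAt.inner ℝ (hγd s).hasDerivAt).deriv
    rw [show (fun t => inner ℝ (γ t) (γ t)) = fun _ => (1 : ℝ) from funext hone] at h
    simp only [deriv_const] at h
    rw [real_inner_comm (γ s) (deriv γ s)] at h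
    have := real_inner_comm (γ s) (deriv γ s)
    linarith
  have hacc' : inner ℝ (γ t) (deriv (deriv γ) t) = (-1 : ℝ) := by
    have h := ((hγd t).hasDerivAt.inner ℝ (hγ'd t).hasDerivAt).deriv
    rw [show (fun t => inner ℝ (γ t) (deriv γ t)) = fun _ => (0 : ℝ) from funext horth] at h
    simp only [deriv_const, real_inner_self_eq_norm_sq, hu t] at h
    linarith
  have htan : ∀ v ∈ tangentSpace M (γ t), inner ℝ (γ t) v = (0 : ℝ) := by
    intro v hv
    refine Submodule.span_induction ?_ ?_ ?_ ?_ hv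
    · rintro v ⟨c, hc, hcM, hc0, rfl⟩
      have hcd : Differentiable ℝ c := hc.differentiable (by simp)
      have h := ((hcd 0).hasDerivAt.inner ℝ (hcd 0).hasDerivAt).deriv
      rw [show (fun t => inner ℝ (c t) (c t)) = fun _ => (1 : ℝ) from funext fun s => by
        have := hM (hcM s)
        rw [mem_sphere_zero_iff_norm] at this
        simp [this]] at h
      simp only [deriv_const, hc0] at h
      have := real_inner_comm (γ t) (deriv c 0)
      linarith
    · simp
    · intro x y _ _ hx hy
      rw [inner_add_right, hx, hy, add_zero]
    · intro a x _ hx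
      rw [inner_smul_right, hx, mul_zero]
  rw [curvature]
  congr 1
  refine Submodule.eq_starProjection_of_mem_orthogonal ?_ ?_
  · rw [normalSpace, Submodule.mem_orthogonal]
    intro u hu
    obtain ⟨v, hv, w, hw, rfl⟩ := Submodule.mem_sup.1 hu
    obtain ⟨a, rfl⟩ := Submodule.mem_span_singleton.1 hw
    have h1 := (Submodule.mem_orthogonal _ _).1 (hacc t) v hv
    have h2 := htan v hv
    rw [real_inner_comm] at h2
    rw [inner_add_left, inner_add_right, inner_add_right, h1, h2, real_inner_smul_left,
      real_inner_smul_left, hacc', hone]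
    ring
  · have h : γ t ∈ (normalSpace M (γ t))ᗮ :=
      Submodule.le_orthogonal_orthogonal _
        (Submodule.mem_sup_right (Submodule.mem_span_singleton_self _))
    simpa using h

end Geometry

end SegreVeronese

end

open scoped ContDiff

noncomputable section

namespace SegreVeronese

/-! Everything follows from one identity: the map `Ψ a = a_1 ^ d_1 ⊗ ⋯ ⊗ a_r ^ d_r` satisfies `⟪Ψ a,
Ψ b⟫ = ∏ ⟪a_i, b_i⟫ ^ d_i` (`IsPowerMap`). If `u_i` and `w_i` are orthogonal to the unit vectors
`a_i`, then `⟪Ψ (a + s u), Ψ (a + t w)⟫ = ∏ (1 + s t ⟪u_i, w_i⟫) ^ d_i` depends on `s t` only. Hence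
the Taylor coefficients of `Ψ` of different orders are orthogonal, and those of equal order have
computable inner products (`IsPowerMap.inner_jets`): the second derivative along `u` has squared
norm `2 ((∑ d_i |u_i|²)² - ∑ d_i |u_i|⁴)`.

A curve in the manifold is locally `g • Ψ(b)`, with each `b_i` moving in the affine hyperplane
touching the sphere at `b_i(t)` (`IsPowerMap.exists_isLocalLift`). Then `b'` and `b''` are
orthogonal to `b(t)`, and the acceleration splits into a normal part `D²Ψ(b', b')`, a tangential
part `DΨ(b'')` and a radial part, up to sign. The curvature is therefore the norm of `D²Ψ(b', b')`,
and being a geodesic means `b'' = 0` in this normalisation.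

With `q_i = |b_i'|²`, unit speed reads `∑ d_i q_i = 1` and the squared curvature is `2 (1 - ∑ d_i
q_i²)`. On this simplex `∑ d_i q_i²` is least, `1 / D`, when all `q_i` equal `1 / D`, and greatest,
`1 / d_l`, when all the mass sits at an index of minimal degree. Images of great circles under the
power maps realise both cases by geodesics. -/

open Polynomial in
-- These coefficients are the elementary symmetric functions of the family in which each `q i` is
-- repeated `d i` times; the last equation is Newton's identity `2 e₂ = p₁² - p₂`, the source of the
-- curvature formula.
lemma coeff_prod_linear_pow {ι : Type*} (S : Finset ι) (d : ι → ℕ) (q : ι → ℝ) :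
    (∏ i ∈ S, (1 + C (q i) * X : ℝ[X]) ^ d i).coeff 0 = 1 ∧
    (∏ i ∈ S, (1 + C (q i) * X : ℝ[X]) ^ d i).coeff 1 = ∑ i ∈ S, d i * q i ∧
    2 * (∏ i ∈ S, (1 + C (q i) * X : ℝ[X]) ^ d i).coeff 2 =
      (∑ i ∈ S, d i * q i) ^ 2 - ∑ i ∈ S, d i * q i ^ 2 := by
  classical
  have mul2 : ∀ f g : ℝ[X], (f * g).coeff 1 = f.coeff 0 * g.coeff 1 + f.coeff 1 * g.coeff 0 ∧
      (f * g).coeff 2 = f.coeff 0 * g.coeff 2 + f.coeff 1 * g.coeff 1 + f.coeff 2 * g.coeff 0 := by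
    intro f g
    refine ⟨mul_coeff_one f g, ?_⟩
    rw [coeff_mul, Finset.Nat.sum_antidiagonal_eq_sum_range_succ
      (fun i j => f.coeff i * g.coeff j)]
    simp [Finset.sum_range_succ]
  have single : ∀ (k : ℕ) (c : ℝ), ((1 + C c * X : ℝ[X]) ^ k).coeff 0 = 1 ∧
      ((1 + C c * X : ℝ[X]) ^ k).coeff 1 = k * c ∧
      2 * ((1 + C c * X : ℝ[X]) ^ k).coeff 2 = (k * c) ^ 2 - k * c ^ 2 := by
    intro k c
    induction k with
    | zero => simp [coeff_one]
    | succ k ih =>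
      obtain ⟨h0, h1, h2⟩ := ih
      rw [pow_succ]
      refine ⟨by rw [mul_coeff_zero, h0]; simp, ?_, ?_⟩
      · rw [(mul2 _ _).1, h0, h1]; simp [coeff_one]; ring
      · rw [(mul2 _ _).2, h0, h1]; simp [coeff_one, coeff_X]; linear_combination h2
  induction S using Finset.induction_on with
  | empty => simp [coeff_one]
  | insert i S hi ih =>
    obtain ⟨h0, h1, h2⟩ := ih
    obtain ⟨k0, k1, k2⟩ := single (d i) (q i)
    simp only [Finset.prod_insert hi, Finset.sum_insert hi]
    refine ⟨by rw [mul_coeff_zero, h0, k0, one_mul], ?_, ?_⟩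
    · rw [(mul2 _ _).1, h0, h1, k0, k1]; ring
    · rw [(mul2 _ _).2, h0, h1, k0, k1]; linear_combination h2 + k2

/-! ### Second-order chain and product rules for curves -/

section Calculus

variable {W E : Type*} [NormedAddCommGroup W] [NormedSpace ℝ W]
  [NormedAddCommGroup E] [InnerProductSpace ℝ E]

/-- Smoothness of `b` is assumed only at `t`, because local lifts are smooth only there;
differentiability nearby is extracted from it. -/
lemma deriv_comp_jet {F : W → E} (hF : ContDiff ℝ ∞ F) {b : ℝ → W} {t : ℝ}
    (hb : ContDiffAt ℝ ∞ b t) :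
    deriv (fun s => F (b s)) t = fderiv ℝ F (b t) (deriv b t) ∧
    deriv (deriv fun s => F (b s)) t =
      fderiv ℝ (fderiv ℝ F) (b t) (deriv b t) (deriv b t) +
        fderiv ℝ F (b t) (deriv (deriv b) t) := by
  have h1 : ∀ s, DifferentiableAt ℝ b s →
      deriv (fun s => F (b s)) s = fderiv ℝ F (b s) (deriv b s) := fun s hs =>
    (((hF.differentiable (by simp)) (b s)).hasFDerivAt.comp_hasDerivAt s hs.hasDerivAt).deriv
  have hev : ∀ᶠ s in nhds t, DifferentiableAt ℝ b s := by
    have := (hb.of_le (m := 1) (by exact_mod_cast le_top)).eventually (by simp)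
    filter_upwards [this] with s hs using hs.differentiableAt (by simp)
  refine ⟨h1 t hev.self_of_nhds, ?_⟩
  have h2 : (deriv fun s => F (b s)) =ᶠ[nhds t] fun s => fderiv ℝ F (b s) (deriv b s) := by
    filter_upwards [hev] with s hs using h1 s hs
  rw [h2.deriv_eq]
  have hb' : DifferentiableAt ℝ (deriv b) t :=
    (ContDiffAt.derivWithin (m := ∞) hb (by simp)).differentiableAt (by simp)
  have hF' : Differentiable ℝ (fderiv ℝ F) :=
    (hF.fderiv_right (m := ∞) (by simp)).differentiable (by simp)
  exact ((hF' (b t)).hasFDerivAt.comp_hasDerivAt t hev.self_of_nhds.hasDerivAt).clm_apply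
    hb'.hasDerivAt |>.deriv

lemma deriv_inner_const {c : ℝ → E} (hc : ContDiff ℝ ∞ c) (x : E) :
    (deriv fun s => inner ℝ x (c s)) = fun s => inner ℝ x (deriv c s) := by
  funext s
  have h := (hasDerivAt_const s x).inner ℝ ((hc.differentiable (by simp)) s).hasDerivAt
  simpa using h.deriv

lemma deriv_deriv_inner_const {c : ℝ → E} (hc : ContDiff ℝ ∞ c) (x : E) :
    (deriv (deriv fun s => inner ℝ x (c s))) = fun s => inner ℝ x (deriv (deriv c) s) := by
  rw [deriv_inner_const hc, deriv_inner_const (contDiff_infty_iff_deriv.1 hc).2]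

lemma deriv_smul_jet {g : ℝ → ℝ} {h : ℝ → E} {t : ℝ} (hg : ContDiffAt ℝ ∞ g t)
    (hh : ContDiffAt ℝ ∞ h t) :
    deriv (fun s => g s • h s) t = g t • deriv h t + deriv g t • h t ∧
    deriv (deriv fun s => g s • h s) t =
      g t • deriv (deriv h) t + (2 * deriv g t) • deriv h t + deriv (deriv g) t • h t := by
  have hge := (hg.of_le (m := 1) (by exact_mod_cast le_top)).eventually (by simp)
  have hhe := (hh.of_le (m := 1) (by exact_mod_cast le_top)).eventually (by simp)
  have h1 : (deriv fun s => g s • h s) =ᶠ[nhds t]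
      fun s => g s • deriv h s + deriv g s • h s := by
    filter_upwards [hge, hhe] with s hs1 hs2
    exact ((hs1.differentiableAt (by simp)).hasDerivAt.smul
      (hs2.differentiableAt (by simp)).hasDerivAt).deriv
  refine ⟨h1.self_of_nhds, ?_⟩
  rw [h1.deriv_eq]
  have g1 := (hg.differentiableAt (by simp)).hasDerivAt
  have h1 := (hh.differentiableAt (by simp)).hasDerivAt
  have g2 := ((ContDiffAt.derivWithin (m := ∞) hg (by simp)).differentiableAt (by simp)).hasDerivAt
  have h2 := ((ContDiffAt.derivWithin (m := ∞) hh (by simp)).differentiableAt (by simp)).hasDerivAt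
  refine ((g1.smul h2).add (g2.smul h1)).deriv.trans ?_
  module

end Calculus

/-! ### Power maps and the inner products of their jets -/

section PowerMap

variable {ι : Type*} [Fintype ι] {V : ι → Type*} [∀ i, NormedAddCommGroup (V i)]
  [∀ i, InnerProductSpace ℝ (V i)] {E : Type*} [NormedAddCommGroup E] [InnerProductSpace ℝ E]

/-- A smooth map on a product of inner product spaces that behaves like
`a ↦ a_1 ^ d_1 ⊗ ⋯ ⊗ a_r ^ d_r` with respect to inner products. -/
structure IsPowerMap (d : ι → ℕ) (Ψ : (∀ i, V i) → E) : Prop where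
  contDiff : ContDiff ℝ ∞ Ψ
  inner_eq : ∀ a b, inner ℝ (Ψ a) (Ψ b) = ∏ i, (inner ℝ (a i) (b i) : ℝ) ^ d i

/-- The image of the product of unit spheres under a map, up to sign. -/
def powerVariety (Ψ : (∀ i, V i) → E) : Set E :=
  {x | ∃ a : ∀ i, V i, (∀ i, ‖a i‖ = 1) ∧ (x = Ψ a ∨ x = -Ψ a)}

namespace IsPowerMap

variable {d : ι → ℕ} {Ψ : (∀ i, V i) → E}

/-- The kernel identity alone forces homogeneity: the squared norm of the difference of the two
sides expands to zero. -/
lemma map_smul (h : IsPowerMap d Ψ) (c : ι → ℝ) (a : ∀ i, V i) :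
    Ψ (fun i => c i • a i) = (∏ i, c i ^ d i) • Ψ a := by
  have h1 : inner ℝ (Ψ fun i => c i • a i) (Ψ a) =
      (∏ i, c i ^ d i) * inner ℝ (Ψ a) (Ψ a) := by
    simp only [h.inner_eq, real_inner_smul_left, mul_pow, Finset.prod_mul_distrib]
  have h2 : inner ℝ (Ψ fun i => c i • a i) (Ψ fun i => c i • a i) =
      (∏ i, c i ^ d i) * ((∏ i, c i ^ d i) * inner ℝ (Ψ a) (Ψ a)) := by
    simp only [h.inner_eq, real_inner_smul_left, real_inner_smul_right, mul_pow,
      Finset.prod_mul_distrib]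
  rw [← sub_eq_zero, ← inner_self_eq_zero (𝕜 := ℝ), inner_sub_left, inner_sub_right,
    inner_sub_right, real_inner_smul_right, real_inner_smul_left, real_inner_smul_left,
    real_inner_smul_right, h2, real_inner_comm (Ψ fun i => c i • a i) (Ψ a), h1]
  ring

lemma inner_self_of_unit (h : IsPowerMap d Ψ) {a : ∀ i, V i} (ha : ∀ i, ‖a i‖ = 1) :
    inner ℝ (Ψ a) (Ψ a) = (1 : ℝ) := by
  rw [h.inner_eq]
  exact Finset.prod_eq_one fun i _ => by simp [ha]

lemma norm_of_unit (h : IsPowerMap d Ψ) {a : ∀ i, V i} (ha : ∀ i, ‖a i‖ = 1) : ‖Ψ a‖ = 1 := by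
  have := h.inner_self_of_unit ha
  rw [real_inner_self_eq_norm_sq] at this
  nlinarith [norm_nonneg (Ψ a)]

lemma norm_of_mem (h : IsPowerMap d Ψ) {x : E} (hx : x ∈ powerVariety Ψ) : ‖x‖ = 1 := by
  obtain ⟨a, ha, rfl | rfl⟩ := hx
  · exact h.norm_of_unit ha
  · rw [norm_neg, h.norm_of_unit ha]

lemma contDiff_line (h : IsPowerMap d Ψ) (a u : ∀ i, V i) :
    ContDiff ℝ ∞ fun s : ℝ => Ψ (a + s • u) :=
  h.contDiff.comp (by fun_prop)

lemma deriv_line (h : IsPowerMap d Ψ) (a u : ∀ i, V i) :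
    deriv (fun s : ℝ => Ψ (a + s • u)) 0 = fderiv ℝ Ψ a u ∧
    deriv (deriv fun s : ℝ => Ψ (a + s • u)) 0 = fderiv ℝ (fderiv ℝ Ψ) a u u := by
  have hd : deriv (fun s : ℝ => a + s • u) = fun _ => u := by
    funext s
    simpa using (((hasDerivAt_id s).smul_const u).const_add a).deriv
  have hj := deriv_comp_jet h.contDiff (b := fun s : ℝ => a + s • u) (t := 0)
    (by fun_prop)
  simpa only [hd, zero_smul, add_zero, deriv_const, map_zero] using hj

open Polynomial in
/-- Inner products of the Taylor coefficients of `Ψ` along lines orthogonal to the base point. -/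
lemma inner_line (h : IsPowerMap d Ψ) {a u w : ∀ i, V i} (ha : ∀ i, ‖a i‖ = 1)
    (hu : ∀ i, inner ℝ (a i) (u i) = (0 : ℝ)) (hw : ∀ i, inner ℝ (a i) (w i) = (0 : ℝ)) (s : ℝ) :
    inner ℝ (Ψ (a + s • u)) (fderiv ℝ Ψ a w) =
      s * ∑ i, d i * (inner ℝ (u i) (w i) : ℝ) ∧
    inner ℝ (Ψ (a + s • u)) (fderiv ℝ (fderiv ℝ Ψ) a w w) =
      s ^ 2 * ((∑ i, d i * (inner ℝ (u i) (w i) : ℝ)) ^ 2 -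
        ∑ i, d i * (inner ℝ (u i) (w i) : ℝ) ^ 2) := by
  obtain ⟨-, p1, p2⟩ := coeff_prod_linear_pow Finset.univ d fun i => (inner ℝ (u i) (w i) : ℝ)
  set p : ℝ[X] := ∏ i, (1 + C (inner ℝ (u i) (w i) : ℝ) * X) ^ d i with hp
  -- Orthogonality to the unit vectors `a i` leaves `1 + s t ⟪u i, w i⟫` in each factor, so the
  -- pairing is a polynomial in the single variable `s t`.
  have key : (fun t : ℝ => inner ℝ (Ψ (a + s • u)) (Ψ (a + t • w))) =
      fun t => p.eval (s * t) := by
    funext t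
    rw [h.inner_eq, hp, eval_prod]
    refine Finset.prod_congr rfl fun i _ => ?_
    have : (inner ℝ (u i) (a i) : ℝ) = 0 := by rw [real_inner_comm, hu]
    simp [inner_add_left, inner_add_right, real_inner_smul_left, real_inner_smul_right, hw, ha,
      this]
    ring
  have dp : ∀ q : ℝ[X], (deriv fun t => q.eval (s * t)) =
      fun t => s * (derivative q).eval (s * t) := by
    intro q
    funext t
    have := ((q.hasDerivAt (s * t)).comp t ((hasDerivAt_id t).const_mul s)).deriv
    simpa [Function.comp_def, mul_comm] using this
  have c0 : ∀ q : ℝ[X], q.eval 0 = q.coeff 0 := fun q => (coeff_zero_eq_eval_zero q).symm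
  constructor
  · rw [← (h.deriv_line a w).1]
    have := congrFun (deriv_inner_const (h.contDiff_line a w) (Ψ (a + s • u))) 0
    rw [← this, key, dp]
    simp only [mul_zero]
    rw [c0, coeff_derivative, p1]
    simp
  · rw [← (h.deriv_line a w).2]
    have := congrFun (deriv_deriv_inner_const (h.contDiff_line a w) (Ψ (a + s • u))) 0
    rw [← this, key, dp]
    have : (deriv fun t => s * (derivative p).eval (s * t)) =
        fun t => s * (s * (derivative (derivative p)).eval (s * t)) := by
      funext t
      have := congrFun (dp (derivative p)) t
      rw [← this]
      exact deriv_const_mul_field _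
    rw [this]
    simp only [mul_zero]
    rw [c0, coeff_derivative, coeff_derivative, ← p2]
    norm_num
    ring

/-- Obtained by differentiating `inner_line` in `s` at `0`. Only monomials `s ^ j * t ^ j` occur, so
position, velocity and second derivative are mutually orthogonal. The factor `2` is `2! * 2!` times
the `1 / 2` in Newton's identity. -/
lemma inner_jets (h : IsPowerMap d Ψ) {a u w : ∀ i, V i} (ha : ∀ i, ‖a i‖ = 1)
    (hu : ∀ i, inner ℝ (a i) (u i) = (0 : ℝ)) (hw : ∀ i, inner ℝ (a i) (w i) = (0 : ℝ)) :
    inner ℝ (Ψ a) (fderiv ℝ Ψ a w) = (0 : ℝ) ∧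
    inner ℝ (Ψ a) (fderiv ℝ (fderiv ℝ Ψ) a w w) = (0 : ℝ) ∧
    inner ℝ (fderiv ℝ Ψ a u) (fderiv ℝ Ψ a w) = ∑ i, d i * (inner ℝ (u i) (w i) : ℝ) ∧
    inner ℝ (fderiv ℝ (fderiv ℝ Ψ) a u u) (fderiv ℝ Ψ a w) = (0 : ℝ) ∧
    inner ℝ (fderiv ℝ (fderiv ℝ Ψ) a u u) (fderiv ℝ (fderiv ℝ Ψ) a w w) =
      2 * ((∑ i, d i * (inner ℝ (u i) (w i) : ℝ)) ^ 2 -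
        ∑ i, d i * (inner ℝ (u i) (w i) : ℝ) ^ 2) := by
  have hl := h.inner_line ha hu hw
  obtain ⟨e1, e2⟩ := h.deriv_line a u
  have hc := h.contDiff_line a u
  set K1 : ℝ := ∑ i, d i * (inner ℝ (u i) (w i) : ℝ) with hK1
  set K2 : ℝ := K1 ^ 2 - ∑ i, d i * (inner ℝ (u i) (w i) : ℝ) ^ 2 with hK2
  have f1 : (fun s : ℝ => (inner ℝ (fderiv ℝ Ψ a w) (Ψ (a + s • u)) : ℝ)) = fun s => s * K1 := by
    funext s; rw [real_inner_comm]; exact (hl s).1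
  have f2 : (fun s : ℝ => (inner ℝ (fderiv ℝ (fderiv ℝ Ψ) a w w) (Ψ (a + s • u)) : ℝ)) =
      fun s => s ^ 2 * K2 := by
    funext s; rw [real_inner_comm]; exact (hl s).2
  have g1 : (deriv fun s : ℝ => s * K1) = fun _ => K1 := by
    funext s; simp
  have g2 : (deriv fun s : ℝ => s ^ 2 * K2) = fun s => 2 * K2 * s := by
    funext s; simp; ring
  have g3 : (deriv fun s : ℝ => 2 * K2 * s) = fun _ => 2 * K2 := by
    funext s; simp
  refine ⟨by simpa using (hl 0).1, by simpa using (hl 0).2, ?_, ?_, ?_⟩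
  · rw [← e1, real_inner_comm, ← congrFun (deriv_inner_const hc _) 0, f1, g1]
  · rw [← e2, real_inner_comm, ← congrFun (deriv_deriv_inner_const hc _) 0, f1, g1]
    simp
  · rw [← e2, real_inner_comm, ← congrFun (deriv_deriv_inner_const hc _) 0, f2, g2, g3]

/-- The pairing of `Ψ b` with a partial derivative of `Ψ`. -/
lemma inner_fderiv_single [DecidableEq ι] (h : IsPowerMap d Ψ) (a b : ∀ i, V i) (i : ι) (y : V i) :
    inner ℝ (Ψ b) (fderiv ℝ Ψ a (Pi.single i y)) =
      d i * (inner ℝ (b i) (a i) : ℝ) ^ (d i - 1) * inner ℝ (b i) y *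
        ∏ j ∈ Finset.univ.erase i, (inner ℝ (b j) (a j) : ℝ) ^ d j := by
  rw [← (h.deriv_line a _).1, ← congrFun (deriv_inner_const (h.contDiff_line a _) (Ψ b)) 0]
  have : (fun s : ℝ => (inner ℝ (Ψ b) (Ψ (a + s • Pi.single i y)) : ℝ)) = fun s =>
      (inner ℝ (b i) (a i) + s * inner ℝ (b i) y : ℝ) ^ d i *
        ∏ j ∈ Finset.univ.erase i, (inner ℝ (b j) (a j) : ℝ) ^ d j := by
    funext s
    rw [h.inner_eq, ← Finset.mul_prod_erase _ _ (Finset.mem_univ i)]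
    congr 1
    · simp [inner_add_right, real_inner_smul_right]
    · refine Finset.prod_congr rfl fun j hj => ?_
      simp [Pi.single_eq_of_ne (Finset.ne_of_mem_erase hj)]
  rw [this]
  simp

end IsPowerMap
end PowerMap

/-! ### Smooth local lifts of curves -/

section LocalLift

variable {ι : Type*} [Fintype ι] {V : ι → Type*} [∀ i, NormedAddCommGroup (V i)]
  [∀ i, InnerProductSpace ℝ (V i)] {E : Type*} [NormedAddCommGroup E] [InnerProductSpace ℝ E]

/-- Near `t`, the curve `γ` is `g • Ψ(b)` with `b` smooth and moving in the affine hyperplanes that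
touch the unit spheres at `b t`. -/
structure IsLocalLift (Ψ : (∀ i, V i) → E) (γ : ℝ → E) (t : ℝ) (g : ℝ → ℝ)
    (b : ℝ → ∀ i, V i) : Prop where
  norm_eq : ∀ i, ‖b t i‖ = 1
  contDiffAt_coeff : ContDiffAt ℝ ∞ g t
  contDiffAt_base : ContDiffAt ℝ ∞ b t
  coeff_eq : g t = 1 ∨ g t = -1
  inner_eq : ∀ᶠ s in nhds t, ∀ i, inner ℝ (b t i) (b s i) = (1 : ℝ)
  eventuallyEq : γ =ᶠ[nhds t] fun s => g s • Ψ (b s)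

variable {d : ι → ℕ} {Ψ : (∀ i, V i) → E}

/-- The lift is given by an explicit formula in `γ`, so no smooth choice of preimages is needed: the
adjoint of the `i`-th partial derivative of `Ψ` at `a` sends `Ψ β` to a multiple of `β i`, and a
scalar normalises it. -/
lemma IsPowerMap.exists_isLocalLift [∀ i, CompleteSpace (V i)] [CompleteSpace E]
    (h : IsPowerMap d Ψ) (hd : ∀ i, 1 ≤ d i)
    {γ : ℝ → E} (hγ : IsCurveIn (powerVariety Ψ) γ) (t : ℝ) {a : ∀ i, V i} (ha : ∀ i, ‖a i‖ = 1)
    (hx : γ t = Ψ a ∨ γ t = -Ψ a) : ∃ g b, IsLocalLift Ψ γ t g b ∧ b t = a := by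
  classical
  let L : ∀ i, V i →L[ℝ] E := fun i => (fderiv ℝ Ψ a).comp (ContinuousLinearMap.single ℝ V i)
  let g : ℝ → ℝ := fun s => inner ℝ (γ s) (Ψ a)
  -- The adjoint vector pairs with `a i` to `d i * g s`; dividing by this number puts `b s i` in the
  -- hyperplane `⟪a i, ·⟫ = 1`.
  let b : ℝ → ∀ i, V i := fun s i =>
    ((d i : ℝ) * g s)⁻¹ • ContinuousLinearMap.adjoint (L i) (γ s)
  have hd0 : ∀ i, (d i : ℝ) ≠ 0 := fun i => Nat.cast_ne_zero.2 (Nat.one_le_iff_ne_zero.1 (hd i))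
  -- The representative `β` is arbitrary at each `s` and need not depend continuously on `s`.
  have key : ∀ s (β : ∀ i, V i) (ε : ℝ), γ s = ε • Ψ β → g s ≠ 0 →
      g s = ε * ∏ i, (inner ℝ (β i) (a i) : ℝ) ^ d i ∧
      ∀ i, (inner ℝ (β i) (a i) : ℝ) ≠ 0 ∧ b s i = (inner ℝ (β i) (a i) : ℝ)⁻¹ • β i := by
    intro s β ε hs hg
    have hgs : g s = ε * ∏ i, (inner ℝ (β i) (a i) : ℝ) ^ d i := by
      change inner ℝ (γ s) (Ψ a) = _
      rw [hs, real_inner_smul_left, h.inner_eq]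
    refine ⟨hgs, fun i => ?_⟩
    have hne : (inner ℝ (β i) (a i) : ℝ) ≠ 0 := by
      intro h0
      apply hg
      rw [hgs, Finset.prod_eq_zero (Finset.mem_univ i), mul_zero]
      rw [h0, zero_pow (Nat.one_le_iff_ne_zero.1 (hd i))]
    refine ⟨hne, ?_⟩
    have hw : ContinuousLinearMap.adjoint (L i) (γ s) =
        (ε * (d i * (inner ℝ (β i) (a i) : ℝ) ^ (d i - 1) *
          ∏ j ∈ Finset.univ.erase i, (inner ℝ (β j) (a j) : ℝ) ^ d j)) • β i := by
      refine ext_inner_right ℝ fun y => ?_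
      rw [ContinuousLinearMap.adjoint_inner_left, hs, real_inner_smul_left, real_inner_smul_left]
      change ε * inner ℝ (Ψ β) (fderiv ℝ Ψ a (Pi.single i y)) = _
      rw [h.inner_fderiv_single]
      ring
    have hgi : (d i : ℝ) * g s = (ε * (d i * (inner ℝ (β i) (a i) : ℝ) ^ (d i - 1) *
          ∏ j ∈ Finset.univ.erase i, (inner ℝ (β j) (a j) : ℝ) ^ d j)) * inner ℝ (β i) (a i) := by
      rw [hgs, ← Finset.mul_prod_erase _ _ (Finset.mem_univ i), ← pow_sub_one_mul
        (Nat.one_le_iff_ne_zero.1 (hd i))]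
      ring
    have hne' : (d i : ℝ) * g s ≠ 0 := mul_ne_zero (hd0 i) hg
    change ((d i : ℝ) * g s)⁻¹ • _ = _
    rw [hw, smul_smul]
    congr 1
    rw [inv_mul_eq_iff_eq_mul₀ hne', hgi, mul_inv_cancel_right₀ hne]
  have hgt : (g t = 1 ∨ g t = -1) := by
    have h1 := h.inner_self_of_unit ha
    rcases hx with hx | hx
    · left; change inner ℝ (γ t) (Ψ a) = (1 : ℝ); rw [hx, h1]
    · right; change inner ℝ (γ t) (Ψ a) = (-1 : ℝ); rw [hx, inner_neg_left, h1]
  have hgt0 : g t ≠ 0 := by rcases hgt with h0 | h0 <;> rw [h0] <;> norm_num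
  have hbt : b t = a := by
    funext i
    have : ∃ ε : ℝ, γ t = ε • Ψ a := by
      rcases hx with hx | hx
      · exact ⟨1, by rw [hx, one_smul]⟩
      · exact ⟨-1, by rw [hx, neg_one_smul]⟩
    obtain ⟨ε, hε⟩ := this
    rw [((key t a ε hε hgt0).2 i).2]
    simp [ha]
  have hgs : ContDiff ℝ ∞ g := hγ.1.inner ℝ contDiff_const
  have hge : ∀ᶠ s in nhds t, g s ≠ 0 := hgs.continuous.continuousAt.eventually_ne hgt0
  have hrep : ∀ s, ∃ β : ∀ i, V i, ∃ ε : ℝ, γ s = ε • Ψ β := by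
    intro s
    obtain ⟨β, -, hβ | hβ⟩ := hγ.2 s
    · exact ⟨β, 1, by rw [hβ, one_smul]⟩
    · exact ⟨β, -1, by rw [hβ, neg_one_smul]⟩
  refine ⟨g, b, ⟨by rwa [hbt], hgs.contDiffAt, ?_, hgt, ?_, ?_⟩, hbt⟩
  · rw [contDiffAt_pi]
    intro i
    refine ContDiffAt.smul ?_ ?_
    · exact (contDiffAt_const.mul hgs.contDiffAt).inv (mul_ne_zero (hd0 i) hgt0)
    · exact ((ContinuousLinearMap.adjoint (L i)).contDiff.comp hγ.1).contDiffAt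
  · filter_upwards [hge] with s hs i
    obtain ⟨β, ε, hβ⟩ := hrep s
    obtain ⟨-, h2⟩ := key s β ε hβ hs
    rw [hbt, (h2 i).2, real_inner_smul_right, real_inner_comm (β i) (a i),
      inv_mul_cancel₀ (h2 i).1]
  · filter_upwards [hge] with s hs
    obtain ⟨β, ε, hβ⟩ := hrep s
    obtain ⟨h1, h2⟩ := key s β ε hβ hs
    rw [show b s = fun i => (inner ℝ (β i) (a i) : ℝ)⁻¹ • β i from funext fun i => (h2 i).2,
      h.map_smul, h1, hβ, smul_smul, mul_assoc, ← Finset.prod_mul_distrib,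
      Finset.prod_eq_one, mul_one]
    intro i _
    rw [← mul_pow, mul_inv_cancel₀ (h2 i).1, one_pow]

namespace IsLocalLift

variable {γ : ℝ → E} {t : ℝ} {g : ℝ → ℝ} {b : ℝ → ∀ i, V i}

lemma deriv_apply (l : IsLocalLift Ψ γ t g b) (i : ι) :
    deriv b t i = deriv (fun s => b s i) t ∧
    deriv (deriv b) t i = deriv (deriv fun s => b s i) t := by
  have h1 : ∀ s, DifferentiableAt ℝ b s → ∀ i, deriv b s i = deriv (fun s => b s i) s := by
    intro s hs i
    exact ((hasDerivAt_pi.1 hs.hasDerivAt) i).deriv.symm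
  have hb := l.contDiffAt_base
  have hev : ∀ᶠ s in nhds t, DifferentiableAt ℝ b s := by
    have := (hb.of_le (m := 1) (by exact_mod_cast le_top)).eventually (by simp)
    filter_upwards [this] with s hs using hs.differentiableAt (by simp)
  refine ⟨h1 t hev.self_of_nhds i, ?_⟩
  have hb' : DifferentiableAt ℝ (deriv b) t :=
    (ContDiffAt.derivWithin (m := ∞) hb (by simp)).differentiableAt (by simp)
  rw [← ((hasDerivAt_pi.1 hb'.hasDerivAt) i).deriv]
  refine Filter.EventuallyEq.deriv_eq ?_
  filter_upwards [hev] with s hs using h1 s hs i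

/-- The relation `⟪b t i, b s i⟫ = 1` near `t` is differentiated twice. This is the advantage over a
lift to the unit spheres, whose second derivative would have a radial part. -/
lemma inner_deriv (l : IsLocalLift Ψ γ t g b) (i : ι) :
    inner ℝ (b t i) (deriv b t i) = (0 : ℝ) ∧ inner ℝ (b t i) (deriv (deriv b) t i) = (0 : ℝ) := by
  have hb : ContDiffAt ℝ ∞ (fun s => b s i) t := contDiffAt_pi.1 l.contDiffAt_base i
  have hev : ∀ᶠ s in nhds t, DifferentiableAt ℝ (fun s => b s i) s := by
    have := (hb.of_le (m := 1) (by exact_mod_cast le_top)).eventually (by simp)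
    filter_upwards [this] with s hs using hs.differentiableAt (by simp)
  have h1 : ∀ s, DifferentiableAt ℝ (fun s => b s i) s →
      deriv (fun s => (inner ℝ (b t i) (b s i) : ℝ)) s =
        inner ℝ (b t i) (deriv (fun s => b s i) s) := by
    intro s hs
    simpa using ((hasDerivAt_const s (b t i)).inner ℝ hs.hasDerivAt).deriv
  have hc : (fun s => (inner ℝ (b t i) (b s i) : ℝ)) =ᶠ[nhds t] fun _ => 1 := by
    filter_upwards [l.inner_eq] with s hs using hs i
  have hc' : (fun s => (inner ℝ (b t i) (deriv (fun s => b s i) s) : ℝ)) =ᶠ[nhds t]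
      fun _ => 0 := by
    filter_upwards [hc.deriv, hev] with s hs hs'
    rw [← h1 s hs', hs, deriv_const]
  rw [(l.deriv_apply i).1, (l.deriv_apply i).2]
  refine ⟨hc'.self_of_nhds, ?_⟩
  have hb' : DifferentiableAt ℝ (deriv fun s => b s i) t :=
    (ContDiffAt.derivWithin (m := ∞) hb (by simp)).differentiableAt (by simp)
  have h2 := ((hasDerivAt_const t (b t i)).inner ℝ hb'.hasDerivAt).deriv
  rw [hc'.deriv_eq] at h2
  simpa using h2.symm

lemma inner_deriv_left (l : IsLocalLift Ψ γ t g b) (i : ι) :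
    inner ℝ (b t i) (deriv b t i) = (0 : ℝ) := (l.inner_deriv i).1

lemma apply_eq (l : IsLocalLift Ψ γ t g b) : γ t = g t • Ψ (b t) := l.eventuallyEq.self_of_nhds

lemma coeff_sq (l : IsLocalLift Ψ γ t g b) : g t * g t = 1 := by
  rcases l.coeff_eq with h | h <;> rw [h] <;> norm_num

/-- First and second derivative of a curve in the power variety in terms of a local lift. -/
lemma deriv_eq (h : IsPowerMap d Ψ) (hγ : IsCurveIn (powerVariety Ψ) γ)
    (l : IsLocalLift Ψ γ t g b) :
    deriv γ t = g t • fderiv ℝ Ψ (b t) (deriv b t) ∧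
    deriv (deriv γ) t = g t • (fderiv ℝ (fderiv ℝ Ψ) (b t) (deriv b t) (deriv b t) +
      fderiv ℝ Ψ (b t) (deriv (deriv b) t)) + deriv (deriv g) t • Ψ (b t) := by
  obtain ⟨j1, j2⟩ := deriv_comp_jet h.contDiff l.contDiffAt_base
  obtain ⟨k1, k2⟩ := deriv_smul_jet (h := fun s => Ψ (b s)) l.contDiffAt_coeff
    (h.contDiff.contDiffAt.comp t l.contDiffAt_base)
  have e1 := l.eventuallyEq.deriv_eq
  have e2 := l.eventuallyEq.deriv.deriv_eq
  rw [k1, j1] at e1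
  rw [k2, j1, j2] at e2
  -- The curve has unit norm, so `γ'` is orthogonal to `γ`; `DΨ(b')` is already orthogonal to
  -- `Ψ(b)`, which leaves no room for a term `g' • Ψ(b)`.
  have hg : deriv g t = 0 := by
    have hone : (fun s => (inner ℝ (γ s) (γ s) : ℝ)) = fun _ => 1 := by
      funext s
      rw [real_inner_self_eq_norm_sq, h.norm_of_mem (hγ.2 s), one_pow]
    have hd := ((hγ.1.differentiable (by simp)) t).hasDerivAt
    have h0 := (hd.inner ℝ hd).deriv
    rw [hone, deriv_const, real_inner_comm, ← two_mul] at h0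
    have h0 : (inner ℝ (deriv γ t) (γ t) : ℝ) = 0 := by linarith
    have h3 := (h.inner_jets l.norm_eq l.inner_deriv_left l.inner_deriv_left).1
    rw [e1, l.apply_eq, inner_add_left, real_inner_smul_left, real_inner_smul_left,
      real_inner_smul_right, real_inner_smul_right, h.inner_self_of_unit l.norm_eq,
      real_inner_comm, h3] at h0
    have := l.coeff_sq
    rcases l.coeff_eq with h5 | h5 <;> rw [h5] at h0 <;> linarith
  rw [hg] at e1 e2
  refine ⟨by simpa using e1, ?_⟩
  rw [e2]
  simp

end IsLocalLift

end LocalLift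

/-! ### Tangent spaces, curvature and geodesics in terms of lifts -/

section PowerVariety

variable {ι : Type*} [Fintype ι] {V : ι → Type*} [∀ i, NormedAddCommGroup (V i)]
  [∀ i, InnerProductSpace ℝ (V i)] {E : Type*} [NormedAddCommGroup E] [InnerProductSpace ℝ E]
  {d : ι → ℕ} {Ψ : (∀ i, V i) → E}

lemma norm_inv_sqrt_smul_add {W : Type*} [NormedAddCommGroup W] [InnerProductSpace ℝ W] {a w : W}
    (ha : ‖a‖ = 1) (hw : inner ℝ a w = (0 : ℝ)) (s : ℝ) :
    ‖(√(1 + s ^ 2 * ‖w‖ ^ 2))⁻¹ • (a + s • w)‖ = 1 := by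
  have h1 : ‖a + s • w‖ ^ 2 = 1 + s ^ 2 * ‖w‖ ^ 2 := by
    rw [norm_add_sq_real, real_inner_smul_right, hw, norm_smul, ha, mul_pow, Real.norm_eq_abs,
      sq_abs]
    ring
  have h2 : √(1 + s ^ 2 * ‖w‖ ^ 2) = ‖a + s • w‖ := by
    rw [← h1, Real.sqrt_sq (norm_nonneg _)]
  have h3 : ‖a + s • w‖ ≠ 0 := by
    intro h0
    rw [h0] at h1
    nlinarith [sq_nonneg (s * ‖w‖)]
  rw [h2, norm_smul, norm_inv, norm_norm, inv_mul_cancel₀ h3]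

/-- The witness is the image of the lines `a i + s • w i` projected radially to the unit spheres.
The normalising factor has zero derivative at `s = 0`, so the initial velocity is still `w`. -/
lemma IsPowerMap.fderiv_mem_tangentSpace (h : IsPowerMap d Ψ) {a w : ∀ i, V i}
    (ha : ∀ i, ‖a i‖ = 1) (hw : ∀ i, inner ℝ (a i) (w i) = (0 : ℝ)) {x : E}
    (hx : x = Ψ a ∨ x = -Ψ a) : fderiv ℝ Ψ a w ∈ tangentSpace (powerVariety Ψ) x := by
  let b : ℝ → ∀ i, V i := fun s i => (√(1 + s ^ 2 * ‖w i‖ ^ 2))⁻¹ • (a i + s • w i)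
  have hpos : ∀ (s : ℝ) i, 0 < 1 + s ^ 2 * ‖w i‖ ^ 2 := fun s i => by positivity
  have hb : ContDiff ℝ ∞ b := by
    rw [contDiff_pi]
    intro i
    refine ContDiff.smul (ContDiff.inv (ContDiff.sqrt (by fun_prop) fun s => (hpos s i).ne')
      fun s => (Real.sqrt_pos.2 (hpos s i)).ne') (by fun_prop)
  have hb0 : b 0 = a := by
    funext i
    simp [b]
  have hb' : HasDerivAt b w 0 := by
    rw [hasDerivAt_pi]
    intro i
    have h1 : HasDerivAt (fun s : ℝ => 1 + s ^ 2 * ‖w i‖ ^ 2) 0 0 := by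
      simpa using (((hasDerivAt_id (0 : ℝ)).pow 2).mul_const (‖w i‖ ^ 2)).const_add 1
    have h2 := (h1.sqrt (hpos 0 i).ne').inv (Real.sqrt_pos.2 (hpos 0 i)).ne'
    have h3 : HasDerivAt (fun s : ℝ => a i + s • w i) (w i) 0 := by
      simpa using ((hasDerivAt_id (0 : ℝ)).smul_const (w i)).const_add (a i)
    refine (h2.smul h3).congr_deriv ?_
    simp
  have hc : ContDiff ℝ ∞ fun s => Ψ (b s) := h.contDiff.comp hb
  have hcd : deriv (fun s => Ψ (b s)) 0 = fderiv ℝ Ψ a w := by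
    rw [(deriv_comp_jet h.contDiff hb.contDiffAt).1, hb'.deriv, hb0]
  have hbn : ∀ s i, ‖b s i‖ = 1 := fun s i => norm_inv_sqrt_smul_add (ha i) (hw i) s
  rcases hx with rfl | rfl
  · exact Submodule.subset_span ⟨_, hc, fun s => ⟨b s, hbn s, Or.inl rfl⟩, by rw [hb0], hcd⟩
  · rw [← neg_neg (fderiv ℝ Ψ a w)]
    refine Submodule.neg_mem _ (Submodule.subset_span
      ⟨fun s => -Ψ (b s), hc.neg, fun s => ⟨b s, hbn s, Or.inr rfl⟩, by simp only [hb0], ?_⟩)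
    rw [← hcd]
    exact deriv.neg

/-- A local lift shows that every velocity has this form; such vectors already form a subspace, so
passing to the span adds nothing. -/
lemma IsPowerMap.mem_tangentSpace_iff [∀ i, CompleteSpace (V i)] [CompleteSpace E]
    (h : IsPowerMap d Ψ) (hd : ∀ i, 1 ≤ d i) {a : ∀ i, V i}
    (ha : ∀ i, ‖a i‖ = 1) {x : E} (hx : x = Ψ a ∨ x = -Ψ a) {v : E} :
    v ∈ tangentSpace (powerVariety Ψ) x ↔
      ∃ w : ∀ i, V i, (∀ i, inner ℝ (a i) (w i) = (0 : ℝ)) ∧ v = fderiv ℝ Ψ a w := by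
  refine ⟨fun hv => ?_, ?_⟩
  · refine Submodule.span_induction ?_ ?_ ?_ ?_ hv
    · rintro v ⟨c, hc, hcM, hc0, rfl⟩
      obtain ⟨g, b, l, hb⟩ := h.exists_isLocalLift hd ⟨hc, hcM⟩ 0 ha (by rwa [hc0])
      refine ⟨g 0 • deriv b 0, fun i => ?_, ?_⟩
      · rw [← hb, Pi.smul_apply, real_inner_smul_right, l.inner_deriv_left, mul_zero]
      · rw [(l.deriv_eq h ⟨hc, hcM⟩).1, hb, _root_.map_smul]
    · exact ⟨0, by simp, by simp⟩
    · rintro _ _ _ _ ⟨w, hw, rfl⟩ ⟨w', hw', rfl⟩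
      exact ⟨w + w', fun i => by rw [Pi.add_apply, inner_add_right, hw, hw', add_zero],
        (map_add _ _ _).symm⟩
    · rintro c _ _ ⟨w, hw, rfl⟩
      exact ⟨c • w, fun i => by rw [Pi.smul_apply, real_inner_smul_right, hw, mul_zero],
        (_root_.map_smul _ _ _).symm⟩
  · rintro ⟨w, hw, rfl⟩
    exact h.fderiv_mem_tangentSpace ha hw hx

namespace IsLocalLift

variable {γ : ℝ → E} {t : ℝ} {g : ℝ → ℝ} {b : ℝ → ∀ i, V i}

lemma apply_eq_or (l : IsLocalLift Ψ γ t g b) : γ t = Ψ (b t) ∨ γ t = -Ψ (b t) := by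
  rw [l.apply_eq]
  rcases l.coeff_eq with h | h <;> simp [h]

lemma norm_deriv_sq (h : IsPowerMap d Ψ) (hγ : IsCurveIn (powerVariety Ψ) γ)
    (l : IsLocalLift Ψ γ t g b) : ‖deriv γ t‖ ^ 2 = ∑ i, d i * ‖deriv b t i‖ ^ 2 := by
  rw [← real_inner_self_eq_norm_sq, (l.deriv_eq h hγ).1, real_inner_smul_left,
    real_inner_smul_right, ← mul_assoc, l.coeff_sq, one_mul,
    (h.inner_jets l.norm_eq l.inner_deriv_left l.inner_deriv_left).2.2.1]
  simp only [real_inner_self_eq_norm_sq]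

/-- Of the three terms of `γ''`, the one in `b''` is tangent and the one in `g''` is a multiple of
`γ t`. The remaining one is orthogonal to both, hence it is the projection, and `inner_jets` gives
its norm. -/
lemma curvature_eq [∀ i, CompleteSpace (V i)] [FiniteDimensional ℝ E]
    (h : IsPowerMap d Ψ) (hd : ∀ i, 1 ≤ d i) (hγ : IsCurveIn (powerVariety Ψ) γ)
    (l : IsLocalLift Ψ γ t g b) :
    curvature (powerVariety Ψ) γ t = √(2 * ((∑ i, d i * ‖deriv b t i‖ ^ 2) ^ 2 -
      ∑ i, d i * (‖deriv b t i‖ ^ 2) ^ 2)) := by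
  have := FiniteDimensional.complete ℝ E
  set B := fderiv ℝ (fderiv ℝ Ψ) (b t) (deriv b t) (deriv b t) with hB
  have hJ := fun (w : ∀ i, V i) (hw : ∀ i, inner ℝ (b t i) (w i) = (0 : ℝ)) =>
    h.inner_jets l.norm_eq l.inner_deriv_left hw
  have hu := hJ _ l.inner_deriv_left
  have hproj : (normalSpace (powerVariety Ψ) (γ t)).starProjection (deriv (deriv γ) t) =
      g t • B := by
    refine Submodule.eq_starProjection_of_mem_orthogonal ?_ ?_
    · rw [normalSpace, Submodule.mem_orthogonal]
      intro y hy
      obtain ⟨v, hv, z, hz, rfl⟩ := Submodule.mem_sup.1 hy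
      obtain ⟨c, rfl⟩ := Submodule.mem_span_singleton.1 hz
      obtain ⟨w, hw, rfl⟩ := (h.mem_tangentSpace_iff hd l.norm_eq l.apply_eq_or).1 hv
      rw [inner_add_left, real_inner_smul_right, real_inner_comm, (hJ w hw).2.2.2.1, l.apply_eq,
        real_inner_smul_left, real_inner_smul_left, real_inner_smul_right, hu.2.1]
      ring
    · refine Submodule.le_orthogonal_orthogonal _ ?_
      rw [(l.deriv_eq h hγ).2, smul_add, add_assoc, add_sub_cancel_left]
      refine Submodule.add_mem_sup ?_ ?_
      · exact Submodule.smul_mem _ _ (h.fderiv_mem_tangentSpace l.norm_eq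
          (fun i => (l.inner_deriv i).2) l.apply_eq_or)
      · refine Submodule.mem_span_singleton.2 ⟨deriv (deriv g) t * g t, ?_⟩
        rw [l.apply_eq, smul_smul, mul_assoc, l.coeff_sq, mul_one]
  have hnorm : ‖g t • B‖ ^ 2 = 2 * ((∑ i, d i * ‖deriv b t i‖ ^ 2) ^ 2 -
      ∑ i, d i * (‖deriv b t i‖ ^ 2) ^ 2) := by
    rw [← real_inner_self_eq_norm_sq, real_inner_smul_left, real_inner_smul_right, ← mul_assoc,
      l.coeff_sq, one_mul, hu.2.2.2.2]
    simp only [real_inner_self_eq_norm_sq]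
  rw [curvature, hproj, ← hnorm, Real.sqrt_sq (norm_nonneg _)]

/-- The tangential part of `γ''` is `DΨ(b'')` up to sign, and the form `∑ d i * ⟪·, ·⟫` is definite
because every `d i` is positive. -/
lemma deriv_deriv_mem_orthogonal_iff [∀ i, CompleteSpace (V i)] [CompleteSpace E]
    (h : IsPowerMap d Ψ) (hd : ∀ i, 1 ≤ d i) (hγ : IsCurveIn (powerVariety Ψ) γ)
    (l : IsLocalLift Ψ γ t g b) :
    deriv (deriv γ) t ∈ (tangentSpace (powerVariety Ψ) (γ t))ᗮ ↔
      ∀ i, deriv (deriv b) t i = 0 := by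
  have hv := fun i => (l.inner_deriv i).2
  have hin : ∀ w : ∀ i, V i, (∀ i, inner ℝ (b t i) (w i) = (0 : ℝ)) →
      inner ℝ (deriv (deriv γ) t) (fderiv ℝ Ψ (b t) w) =
        g t * ∑ i, d i * (inner ℝ (deriv (deriv b) t i) (w i) : ℝ) := by
    intro w hw
    rw [(l.deriv_eq h hγ).2, inner_add_left, real_inner_smul_left, real_inner_smul_left,
      inner_add_left, (h.inner_jets l.norm_eq l.inner_deriv_left hw).2.2.2.1,
      (h.inner_jets l.norm_eq hv hw).2.2.1, (h.inner_jets l.norm_eq hv hw).1]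
    ring
  rw [Submodule.mem_orthogonal']
  constructor
  · intro H i
    -- The test vector is `DΨ(b'')` itself, which turns the pairing into a sum of squares.
    have h1 := H _ (h.fderiv_mem_tangentSpace l.norm_eq hv l.apply_eq_or)
    rw [hin _ hv] at h1
    have hg : g t ≠ 0 := by rcases l.coeff_eq with h | h <;> rw [h] <;> norm_num
    have h2 := (mul_eq_zero.1 h1).resolve_left hg
    rw [Finset.sum_eq_zero_iff_of_nonneg
      (fun i _ => mul_nonneg (Nat.cast_nonneg _) real_inner_self_nonneg)] at h2
    have h3 := (mul_eq_zero.1 (h2 i (Finset.mem_univ i))).resolve_left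
      (Nat.cast_ne_zero.2 (Nat.one_le_iff_ne_zero.1 (hd i)))
    exact inner_self_eq_zero.1 h3
  · intro H y hy
    obtain ⟨w, hw, rfl⟩ := (h.mem_tangentSpace_iff hd l.norm_eq l.apply_eq_or).1 hy
    rw [hin w hw, Finset.sum_eq_zero fun i _ => by rw [H i, inner_zero_left, mul_zero], mul_zero]

end IsLocalLift

end PowerVariety

/-! ### Normalising preimages, and curves over great circles -/

section CircularCurves

variable {ι : Type*} [Fintype ι] {V : ι → Type*} [∀ i, NormedAddCommGroup (V i)]
  [∀ i, InnerProductSpace ℝ (V i)] {E : Type*} [NormedAddCommGroup E] [InnerProductSpace ℝ E]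
  {d : ι → ℕ} {Ψ : (∀ i, V i) → E}

/-- Normalising each factor multiplies `Ψ a` by the inverse of `∏ ‖a i‖ ^ d i`, which is `‖Ψ a‖ =
1`. -/
lemma IsPowerMap.exists_unit (h : IsPowerMap d Ψ) (hd : ∀ i, 1 ≤ d i) {a : ∀ i, V i}
    (ha : ‖Ψ a‖ = 1) : ∃ a' : ∀ i, V i, (∀ i, ‖a' i‖ = 1) ∧ Ψ a' = Ψ a := by
  have h1 : (∏ i, ‖a i‖ ^ d i) ^ 2 = 1 := by
    have := h.inner_eq a a
    rw [real_inner_self_eq_norm_sq, ha] at this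
    simp only [real_inner_self_eq_norm_sq] at this
    rw [← Finset.prod_pow, Finset.prod_congr rfl fun i _ => pow_right_comm ‖a i‖ (d i) 2, ← this,
      one_pow]
  have h2 : ∏ i, ‖a i‖ ^ d i = 1 := by
    have : 0 ≤ ∏ i, ‖a i‖ ^ d i := Finset.prod_nonneg fun i _ => by positivity
    nlinarith
  have hne : ∀ i, ‖a i‖ ≠ 0 := by
    intro i h0
    rw [Finset.prod_eq_zero (Finset.mem_univ i)] at h2
    · exact zero_ne_one h2
    · rw [h0, zero_pow (Nat.one_le_iff_ne_zero.1 (hd i))]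
  refine ⟨fun i => ‖a i‖⁻¹ • a i, fun i => ?_, ?_⟩
  · rw [norm_smul, norm_inv, norm_norm, inv_mul_cancel₀ (hne i)]
  · rw [h.map_smul]
    simp only [inv_pow, Finset.prod_inv_distrib, h2, inv_one, one_smul]

/-- Euler's relation for homogeneous maps; the value of the constant plays no role. -/
lemma IsPowerMap.exists_fderiv_self (h : IsPowerMap d Ψ) (a : ∀ i, V i) :
    ∃ c : ℝ, fderiv ℝ Ψ a a = c • Ψ a := by
  have h1 : (fun s : ℝ => Ψ (a + s • a)) = fun s => (∏ i, (1 + s) ^ d i) • Ψ a := by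
    funext s
    rw [← h.map_smul]
    congr 1
    funext i
    simp [add_smul]
  refine ⟨deriv (fun s : ℝ => ∏ i, (1 + s) ^ d i) 0, ?_⟩
  rw [← (h.deriv_line a a).1, h1]
  have h2 : DifferentiableAt ℝ (fun s : ℝ => ∏ i, (1 + s) ^ d i) 0 := by fun_prop
  exact (h2.hasDerivAt.smul_const _).deriv

/-- Curves in the power variety that come from curves of constant speed on great circles. -/
lemma IsPowerMap.deriv_of_circular [∀ i, CompleteSpace (V i)] [CompleteSpace E]
    (h : IsPowerMap d Ψ) (hd : ∀ i, 1 ≤ d i) {b : ℝ → ∀ i, V i} (hb : ContDiff ℝ ∞ b)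
    (hn : ∀ s i, ‖b s i‖ = 1) (ho : ∀ s i, inner ℝ (b s i) (deriv b s i) = (0 : ℝ)) {c : ℝ}
    (hc : ∀ s, deriv (deriv b) s = c • b s) (t : ℝ) :
    ‖deriv (fun s => Ψ (b s)) t‖ ^ 2 = ∑ i, d i * ‖deriv b t i‖ ^ 2 ∧
    deriv (deriv fun s => Ψ (b s)) t ∈ (tangentSpace (powerVariety Ψ) (Ψ (b t)))ᗮ := by
  obtain ⟨j1, j2⟩ := deriv_comp_jet h.contDiff (hb.contDiffAt (x := t))
  constructor
  · rw [← real_inner_self_eq_norm_sq, j1, (h.inner_jets (hn t) (ho t) (ho t)).2.2.1]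
    simp only [real_inner_self_eq_norm_sq]
  · rw [Submodule.mem_orthogonal']
    intro y hy
    obtain ⟨w, hw, rfl⟩ := (h.mem_tangentSpace_iff hd (hn t) (Or.inl rfl)).1 hy
    obtain ⟨e, he⟩ := h.exists_fderiv_self (b t)
    have hJ := h.inner_jets (hn t) (ho t) hw
    -- Since `b''` is a multiple of `b`, Euler's relation makes `DΨ(b'')` a multiple of `Ψ(b)`,
    -- which is orthogonal to all tangent vectors.
    rw [j2, hc, _root_.map_smul, he, inner_add_left, hJ.2.2.2.1, real_inner_smul_left,
      real_inner_smul_left, hJ.1]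
    ring

end CircularCurves

/-! ### The Veronese and Segre–Veronese maps are power maps -/

section Maps

/-- The `k`-th power of the linear form with coefficients `a`. -/
def linearPower (n k : ℕ) (a : EuclideanSpace ℝ (Fin (n + 1))) : Form n k :=
  (Form.coordEquiv n k).symm fun α => weight α * ∏ j, a j ^ α.1 j

lemma Form.basis_repr_apply {n k : ℕ} (f : Form n k) (α : Exponent n k) :
    (Form.basis n k).repr f α = Form.coordEquiv n k f α := by
  rw [Form.basis, Module.Basis.ofEquivFun_repr_apply]

lemma Form.inner_eq {n k : ℕ} (f g : Form n k) :
    inner ℝ f g = ∑ α, Form.coordEquiv n k f α * Form.coordEquiv n k g α := by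
  simp only [← Form.basis_repr_apply]
  rfl

lemma weight_sq {n k : ℕ} (α : Exponent n k) : weight α * weight α = α.1.multinomial :=
  Real.mul_self_sqrt (Nat.cast_nonneg _)

lemma Form.degree_eq_of_coeff_ne_zero {n k : ℕ} (f : Form n k) {m : Fin (n + 1) →₀ ℕ}
    (hm : MvPolynomial.coeff m f.toPoly ≠ 0) : m.degree = k := by
  rw [Finsupp.degree_eq_weight_one (R := ℕ)]
  exact (MvPolynomial.mem_homogeneousSubmodule k f.1).1 f.2 hm

/-- The multinomial theorem: one factor `weight` comes from the coordinate, another from the scaled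
monomial, and their product is the multinomial coefficient. -/
lemma toPoly_linearPower (n k : ℕ) (a : EuclideanSpace ℝ (Fin (n + 1))) :
    (linearPower n k a).toPoly = (∑ j, a j • MvPolynomial.X j) ^ k := by
  ext m
  rw [MvPolynomial.coeff_linearCombination_X_pow_of_fintype]
  have hsum : m.sum (fun _ x => x) = ∑ j, m j := Finsupp.sum_fintype _ _ fun _ => rfl
  split_ifs with hm
  · have hmem : m ∈ (Finset.univ : Finset (Fin (n + 1))).finsuppAntidiag k :=
      Finset.mem_finsuppAntidiag.2 ⟨hsum.symm.trans hm, Finset.subset_univ _⟩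
    have h1 : Form.coordEquiv n k (linearPower n k a) ⟨m, hmem⟩ =
        weight ⟨m, hmem⟩ * ∏ j, a j ^ m j := by
      rw [linearPower, LinearEquiv.apply_symm_apply]
    change MvPolynomial.coeff m (linearPower n k a).toPoly / weight ⟨m, hmem⟩ = _ at h1
    rw [div_eq_iff (weight_ne_zero _), mul_right_comm, weight_sq] at h1
    rw [h1, Finsupp.prod_fintype _ _ fun _ => pow_zero _]
  · by_contra hne
    apply hm
    rw [hsum, ← Finsupp.degree_eq_sum]
    exact Form.degree_eq_of_coeff_ne_zero _ hne

/-- The reproducing property of the Bombieri–Weyl product: the sum over exponents is the multinomial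
expansion of `(∑ j, a j * b j) ^ k`. -/
lemma inner_linearPower (n k : ℕ) (a b : EuclideanSpace ℝ (Fin (n + 1))) :
    inner ℝ (linearPower n k a) (linearPower n k b) = (inner ℝ a b : ℝ) ^ k := by
  have h1 : (inner ℝ a b : ℝ) = ∑ j, a j * b j := by
    simp [PiLp.inner_apply, mul_comm]
  rw [Form.inner_eq, h1, Finset.sum_pow_eq_sum_piAntidiag]
  simp only [linearPower, LinearEquiv.apply_symm_apply, weight]
  rw [Finset.sum_coe_sort ((Finset.univ : Finset (Fin (n + 1))).finsuppAntidiag k)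
    (fun α : Fin (n + 1) →₀ ℕ => (√(α.multinomial : ℝ) * ∏ j, a j ^ α j) *
      (√(α.multinomial : ℝ) * ∏ j, b j ^ α j))]
  refine Finset.sum_bij (fun α _ => ⇑α) ?_ ?_ ?_ ?_
  · intro α hα
    rw [Finset.mem_piAntidiag]
    exact ⟨(Finset.mem_finsuppAntidiag.1 hα).1, fun _ _ => Finset.mem_univ _⟩
  · intro α _ β _ hαβ
    exact DFunLike.coe_injective hαβ
  · intro f hf
    refine ⟨Finsupp.equivFunOnFinite.symm f, ?_, rfl⟩
    exact Finset.mem_finsuppAntidiag.2 ⟨(Finset.mem_piAntidiag.1 hf).1, Finset.subset_univ _⟩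
  · intro α _
    rw [← Finsupp.multinomial_eq_of_support_subset (Finset.subset_univ α.support),
      mul_mul_mul_comm, Real.mul_self_sqrt (Nat.cast_nonneg _), ← Finset.prod_mul_distrib]
    simp only [mul_pow]

lemma contDiff_linearPower (n k : ℕ) : ContDiff ℝ ∞ (linearPower n k) := by
  have h : linearPower n k = fun a => ∑ α, (weight α * ∏ j, a j ^ α.1 j) • scaledMonomial α := by
    funext a
    rfl
  rw [h]
  refine ContDiff.sum fun α _ => ContDiff.fun_smul (contDiff_const.mul ?_) contDiff_const
  refine contDiff_prod fun j _ => ContDiff.pow ?_ _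
  exact (EuclideanSpace.proj j : EuclideanSpace ℝ (Fin (n + 1)) →L[ℝ] ℝ).contDiff

lemma Form.toPoly_injective {n k : ℕ} : Function.Injective (Form.toPoly (n := n) (k := k)) :=
  Subtype.val_injective

lemma exists_toPoly_eq_sum {n : ℕ} (l : Form n 1) :
    ∃ a : EuclideanSpace ℝ (Fin (n + 1)), l.toPoly = ∑ j, a j • MvPolynomial.X j := by
  refine ⟨WithLp.toLp 2 fun j => MvPolynomial.coeff (Finsupp.single j 1) l.toPoly, ?_⟩
  ext m
  rw [← pow_one (∑ j, _), MvPolynomial.coeff_linearCombination_X_pow_of_fintype]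
  have hsum : m.sum (fun _ x => x) = m.degree := by
    rw [Finsupp.degree_eq_sum]
    exact Finsupp.sum_fintype _ _ fun _ => rfl
  split_ifs with hm
  · rw [Finsupp.sum_eq_one_iff] at hm
    obtain ⟨j, rfl⟩ := hm
    simp [Finsupp.multinomial_eq]
  · by_contra hne
    apply hm
    rw [hsum]
    exact l.degree_eq_of_coeff_ne_zero hne

lemma mem_veroneseCone_iff {n k : ℕ} {f : Form n k} :
    f ∈ veroneseCone n k ↔ ∃ a, f = linearPower n k a ∨ f = -linearPower n k a := by
  constructor
  · rintro ⟨l, hl⟩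
    obtain ⟨a, ha⟩ := exists_toPoly_eq_sum l
    rw [ha, ← toPoly_linearPower, ← map_neg] at hl
    exact ⟨a, hl.imp (fun h => Form.toPoly_injective h) fun h => Form.toPoly_injective h⟩
  · rintro ⟨a, ha⟩
    refine ⟨linearPower n 1 a, ?_⟩
    rw [toPoly_linearPower n 1 a, pow_one, ← toPoly_linearPower, ← map_neg]
    exact ha.imp (congrArg _) (congrArg _)

lemma PSTensor.basis_repr_tensor {r : ℕ} {n d : Fin r → ℕ} (f : ∀ i, Form (n i) (d i))
    (α : ∀ i, Exponent (n i) (d i)) :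
    (PSTensor.basis n d).repr (tensor n d f) α = ∏ i, Form.coordEquiv _ _ (f i) (α i) := by
  simp only [← Form.basis_repr_apply]
  exact Basis.piTensorProduct_repr_tprod_apply (fun i => Form.basis (n i) (d i)) f α

/-- Coordinates of a decomposable tensor are products of coordinates, so the sum over multi-indices
factors by distributivity. -/
lemma inner_tensor {r : ℕ} {n d : Fin r → ℕ} (f g : ∀ i, Form (n i) (d i)) :
    inner ℝ (tensor n d f) (tensor n d g) = ∏ i, (inner ℝ (f i) (g i) : ℝ) := by
  have h : inner ℝ (tensor n d f) (tensor n d g) = ∑ α : ∀ i, Exponent (n i) (d i),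
      (PSTensor.basis n d).repr (tensor n d f) α * (PSTensor.basis n d).repr (tensor n d g) α := rfl
  rw [h]
  simp only [PSTensor.basis_repr_tensor, Form.inner_eq, ← Finset.prod_mul_distrib]
  rw [Finset.prod_univ_sum, Fintype.piFinset_univ]

lemma contDiff_tensor {r : ℕ} (n d : Fin r → ℕ) : ContDiff ℝ ∞ (tensor n d) := by
  have h : ⇑(tensor n d) = fun f => ∑ α,
      (∏ i, Form.coordEquiv (n i) (d i) (f i) (α i)) • PSTensor.basis n d α := by
    funext f
    simp only [← PSTensor.basis_repr_tensor]
    exact ((PSTensor.basis n d).sum_repr _).symm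
  rw [h]
  refine ContDiff.sum fun α _ => ContDiff.fun_smul (contDiff_prod fun i _ => ?_) contDiff_const
  let c : Form (n i) (d i) →ₗ[ℝ] ℝ :=
    (LinearMap.proj (α i)).comp (Form.coordEquiv (n i) (d i)).toLinearMap
  exact c.toContinuousLinearMap.contDiff.comp (contDiff_pi.1 contDiff_id i)

/-- The Veronese map, as a map on a product with a single factor. -/
def veroneseMap (n k : ℕ) (a : Unit → EuclideanSpace ℝ (Fin (n + 1))) : Form n k :=
  linearPower n k (a ())

/-- The Segre-Veronese map. -/
def segreVeroneseMap {r : ℕ} (n d : Fin r → ℕ) (a : ∀ i, EuclideanSpace ℝ (Fin (n i + 1))) :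
    PSTensor n d :=
  tensor n d fun i => linearPower (n i) (d i) (a i)

lemma isPowerMap_veroneseMap (n k : ℕ) : IsPowerMap (fun _ => k) (veroneseMap n k) where
  contDiff := (contDiff_linearPower n k).comp (contDiff_apply ℝ _ ())
  inner_eq a b := by simp [veroneseMap, inner_linearPower]

lemma isPowerMap_segreVeroneseMap {r : ℕ} (n d : Fin r → ℕ) :
    IsPowerMap d (segreVeroneseMap n d) where
  contDiff := (contDiff_tensor n d).comp (contDiff_pi.2 fun i =>
    (contDiff_linearPower (n i) (d i)).comp (contDiff_pi.1 contDiff_id i))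
  inner_eq a b := by simp only [segreVeroneseMap, inner_tensor, inner_linearPower]

end Maps

/-! ### The manifolds as power varieties, and products of curves -/

section Manifolds

lemma veronese_eq {n k : ℕ} (hk : 1 ≤ k) : veronese n k = powerVariety (veroneseMap n k) := by
  have h := isPowerMap_veroneseMap n k
  ext f
  constructor
  · rintro ⟨hf, hn⟩
    rw [mem_sphere_zero_iff_norm] at hn
    obtain ⟨a, ha⟩ := mem_veroneseCone_iff.1 hf
    have h1 : ‖veroneseMap n k fun _ => a‖ = 1 := by
      rcases ha with rfl | rfl
      · exact hn
      · rwa [norm_neg] at hn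
    obtain ⟨a', ha', he⟩ := h.exists_unit (fun _ => hk) h1
    refine ⟨a', ha', ?_⟩
    rw [he]
    exact ha
  · intro hf
    refine ⟨?_, mem_sphere_zero_iff_norm.2 (h.norm_of_mem hf)⟩
    obtain ⟨a, -, ha⟩ := hf
    exact mem_veroneseCone_iff.2 ⟨a (), ha⟩

variable {r : ℕ} {n d : Fin r → ℕ}

/-- The signs of the factors multiply to one global sign. Conversely a global minus sign must be
carried by some factor, which is why `r` must be positive. -/
lemma segreVeronese_eq (hr : 0 < r) (hd : ∀ i, 1 ≤ d i) :
    segreVeronese n d = powerVariety (segreVeroneseMap n d) := by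
  have h := isPowerMap_segreVeroneseMap n d
  ext F
  constructor
  · rintro ⟨⟨f, hf, rfl⟩, hn⟩
    rw [mem_sphere_zero_iff_norm] at hn
    have hf' : ∀ i, ∃ (a : EuclideanSpace ℝ (Fin (n i + 1))) (ε : ℝ), |ε| = 1 ∧
        f i = ε • linearPower (n i) (d i) a := by
      intro i
      obtain ⟨a, ha | ha⟩ := mem_veroneseCone_iff.1 (hf i)
      · exact ⟨a, 1, by simp, by rw [ha, one_smul]⟩
      · exact ⟨a, -1, by simp, by rw [ha, neg_one_smul]⟩
    choose a ε hε ha using hf'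
    have hF : tensor n d f = (∏ i, ε i) • segreVeroneseMap n d a := by
      rw [funext ha, MultilinearMap.map_smul_univ]
      rfl
    have hε' : |∏ i, ε i| = 1 := by
      rw [Finset.abs_prod, Finset.prod_eq_one fun i _ => hε i]
    rw [hF, norm_smul, Real.norm_eq_abs, hε', one_mul] at hn
    obtain ⟨a', ha', he⟩ := h.exists_unit hd hn
    refine ⟨a', ha', ?_⟩
    rw [hF, he]
    rcases (abs_eq zero_le_one).1 hε' with h1 | h1 <;> rw [h1]
    · exact Or.inl (one_smul _ _)
    · exact Or.inr (neg_one_smul _ _)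
  · intro hF
    refine ⟨?_, mem_sphere_zero_iff_norm.2 (h.norm_of_mem hF)⟩
    obtain ⟨a, -, rfl | rfl⟩ := hF
    · exact ⟨_, fun i => mem_veroneseCone_iff.2 ⟨a i, Or.inl rfl⟩, rfl⟩
    · let ε : Fin r → ℝ := Function.update 1 ⟨0, hr⟩ (-1)
      refine ⟨fun i => ε i • linearPower (n i) (d i) (a i), fun i => ?_, ?_⟩
      · refine mem_veroneseCone_iff.2 ⟨a i, ?_⟩
        by_cases hi : i = ⟨0, hr⟩
        · right
          simp [ε, hi]
        · left
          simp [ε, hi]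
      · rw [MultilinearMap.map_smul_univ, Finset.prod_update_of_mem (Finset.mem_univ _)]
        simp [segreVeroneseMap]

lemma tensor_mem_segreVeronese {f : ∀ i, Form (n i) (d i)} (hf : ∀ i, f i ∈ veronese (n i) (d i)) :
    tensor n d f ∈ segreVeronese n d := by
  refine ⟨⟨f, fun i => (hf i).1, rfl⟩, ?_⟩
  have h1 : ∀ i, ‖f i‖ = 1 := fun i => mem_sphere_zero_iff_norm.1 (hf i).2
  have h2 := inner_tensor f f
  rw [Finset.prod_eq_one fun i _ => by rw [real_inner_self_eq_norm_sq, h1, one_pow],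
    real_inner_self_eq_norm_sq] at h2
  rw [mem_sphere_zero_iff_norm]
  nlinarith [norm_nonneg (tensor n d f)]

lemma isCurveIn_tensor {γ : ∀ i, ℝ → Form (n i) (d i)}
    (hγ : ∀ i, IsCurveIn (veronese (n i) (d i)) (γ i)) :
    IsCurveIn (segreVeronese n d) fun t => tensor n d fun i => γ i t :=
  ⟨(contDiff_tensor n d).comp (contDiff_pi.2 fun i => (hγ i).1),
    fun t => tensor_mem_segreVeronese fun i => (hγ i).2 t⟩

/-- The normalisation of lifts is imposed factor by factor, so lifts of the factors assemble
directly; speed and geodesy of the product are then read off from the factors. -/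
lemma isLocalLift_tensor {γ : ∀ i, ℝ → Form (n i) (d i)} {t : ℝ} {g : Fin r → ℝ → ℝ}
    {b : ∀ i, ℝ → Unit → EuclideanSpace ℝ (Fin (n i + 1))}
    (l : ∀ i, IsLocalLift (veroneseMap (n i) (d i)) (γ i) t (g i) (b i)) :
    IsLocalLift (segreVeroneseMap n d) (fun s => tensor n d fun i => γ i s) t
      (fun s => ∏ i, g i s) fun s i => b i s () where
  norm_eq i := (l i).norm_eq ()
  contDiffAt_coeff := contDiffAt_prod fun i _ => (l i).contDiffAt_coeff
  contDiffAt_base := contDiffAt_pi.2 fun i => contDiffAt_pi.1 (l i).contDiffAt_base ()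
  coeff_eq := by
    rw [← abs_eq zero_le_one, Finset.abs_prod]
    exact Finset.prod_eq_one fun i _ => (abs_eq zero_le_one).2 (l i).coeff_eq
  inner_eq := by
    filter_upwards [Filter.eventually_all.2 fun i => (l i).inner_eq] with s hs i using hs i ()
  eventuallyEq := by
    filter_upwards [Filter.eventually_all.2 fun i => (l i).eventuallyEq] with s hs
    simp only [hs, MultilinearMap.map_smul_univ]
    rfl

/-- Existence of local lifts for curves in the Veronese manifold and of the product lift. -/
lemma exists_isLocalLift_tensor (hd : ∀ i, 1 ≤ d i) {γ : ∀ i, ℝ → Form (n i) (d i)}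
    (hγ : ∀ i, IsCurveIn (veronese (n i) (d i)) (γ i)) (t : ℝ) :
    ∃ g b, IsLocalLift (segreVeroneseMap n d) (fun s => tensor n d fun i => γ i s) t g b ∧
      (∀ i, ‖deriv (γ i) t‖ ^ 2 = d i * ‖deriv b t i‖ ^ 2) ∧
      ∀ i, deriv (deriv (γ i)) t ∈ (tangentSpace (veronese (n i) (d i)) (γ i t))ᗮ ↔
        deriv (deriv b) t i = 0 := by
  have hγ' : ∀ i, IsCurveIn (powerVariety (veroneseMap (n i) (d i))) (γ i) := fun i => by
    rw [← veronese_eq (hd i)]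
    exact hγ i
  have hcomp : ∀ i, CompleteSpace (Form (n i) (d i)) := fun i => FiniteDimensional.complete ℝ _
  have hl : ∀ i, ∃ g b, IsLocalLift (veroneseMap (n i) (d i)) (γ i) t g b := by
    intro i
    obtain ⟨a, ha, hx⟩ := (hγ' i).2 t
    obtain ⟨g, b, l, -⟩ := (isPowerMap_veroneseMap (n i) (d i)).exists_isLocalLift (fun _ => hd i)
      (hγ' i) t ha hx
    exact ⟨g, b, l⟩
  choose g b l using hl
  have L := isLocalLift_tensor l
  refine ⟨_, _, L, fun i => ?_, fun i => ?_⟩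
  · rw [(l i).norm_deriv_sq (isPowerMap_veroneseMap _ _) (hγ' i), (L.deriv_apply i).1]
    simp [((l i).deriv_apply ()).1]
  · rw [veronese_eq (hd i), (l i).deriv_deriv_mem_orthogonal_iff (isPowerMap_veroneseMap _ _)
      (fun _ => hd i) (hγ' i), (L.deriv_apply i).2]
    simp [((l i).deriv_apply ()).2]

/-- The image of a great circle run at angular speed `θ`; `1 ≤ n` provides the two orthonormal
vectors. The parameter `θ` is free because the two extremal cases need different speeds. -/
lemma exists_circular_curve {n k : ℕ} (hn : 1 ≤ n) (hk : 1 ≤ k) (θ : ℝ) :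
    ∃ γ : ℝ → Form n k, IsCurveIn (veronese n k) γ ∧ (∀ t, ‖deriv γ t‖ ^ 2 = k * θ ^ 2) ∧
      ∀ t, deriv (deriv γ) t ∈ (tangentSpace (veronese n k) (γ t))ᗮ := by
  let e₀ : EuclideanSpace ℝ (Fin (n + 1)) := EuclideanSpace.single 0 1
  let e₁ : EuclideanSpace ℝ (Fin (n + 1)) := EuclideanSpace.single (Fin.last n) 1
  have hlast : (0 : Fin (n + 1)) ≠ Fin.last n := by
    intro h0
    have := congrArg Fin.val h0
    simp at this
    omega
  have h00 : (inner ℝ e₀ e₀ : ℝ) = 1 := by simp [e₀]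
  have h11 : (inner ℝ e₁ e₁ : ℝ) = 1 := by simp [e₁]
  have h01 : (inner ℝ e₀ e₁ : ℝ) = 0 := by
    rw [EuclideanSpace.inner_single_left]
    simp [e₁, hlast]
  have h10 : (inner ℝ e₁ e₀ : ℝ) = 0 := by rw [real_inner_comm, h01]
  let b : ℝ → Unit → EuclideanSpace ℝ (Fin (n + 1)) := fun s _ =>
    Real.cos (θ * s) • e₀ + Real.sin (θ * s) • e₁
  let b' : ℝ → Unit → EuclideanSpace ℝ (Fin (n + 1)) := fun s _ =>
    θ • (-Real.sin (θ * s) • e₀ + Real.cos (θ * s) • e₁)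
  have hlin : ∀ s, HasDerivAt (fun s => θ * s) θ s := fun s => by
    simpa using (hasDerivAt_id s).const_mul θ
  have hb' : deriv b = b' := by
    funext s
    refine HasDerivAt.deriv (hasDerivAt_pi.2 fun _ => ?_)
    refine (((hlin s).cos.smul_const e₀).add ((hlin s).sin.smul_const e₁)).congr_deriv ?_
    simp only [b']
    module
  have hb'' : ∀ s, deriv (deriv b) s = (-θ ^ 2) • b s := by
    intro s
    rw [hb']
    refine HasDerivAt.deriv (hasDerivAt_pi.2 fun _ => ?_)
    refine ((((hlin s).sin.neg.smul_const e₀).add ((hlin s).cos.smul_const e₁)).const_smul θ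
      ).congr_deriv ?_
    simp only [b, Pi.smul_apply]
    module
  have hb : ContDiff ℝ ∞ b := contDiff_pi.2 fun _ => by
    refine ContDiff.add (ContDiff.fun_smul ?_ contDiff_const)
      (ContDiff.fun_smul ?_ contDiff_const)
    · exact Real.contDiff_cos.comp (contDiff_const.mul contDiff_id)
    · exact Real.contDiff_sin.comp (contDiff_const.mul contDiff_id)
  have hnorm : ∀ s i, ‖b s i‖ = 1 := by
    intro s i
    have h1 : ‖b s i‖ ^ 2 = 1 := by
      rw [← real_inner_self_eq_norm_sq]
      simp only [b, inner_add_left, inner_add_right, real_inner_smul_left, real_inner_smul_right,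
        h00, h01, h10, h11]
      linear_combination Real.cos_sq_add_sin_sq (θ * s)
    nlinarith [norm_nonneg (b s i)]
  have horth : ∀ s i, inner ℝ (b s i) (deriv b s i) = (0 : ℝ) := by
    intro s i
    rw [hb']
    simp only [b, b', inner_add_left, inner_add_right, real_inner_smul_left, real_inner_smul_right,
      h00, h01, h10, h11]
    ring
  have hcomp : CompleteSpace (Form n k) := FiniteDimensional.complete ℝ _
  have h := isPowerMap_veroneseMap n k
  have key := h.deriv_of_circular (fun _ => hk) hb hnorm horth hb''
  refine ⟨fun s => veroneseMap n k (b s), ⟨h.contDiff.comp hb, fun s => ?_⟩, fun t => ?_,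
    fun t => ?_⟩
  · rw [veronese_eq hk]
    exact ⟨b s, hnorm s, Or.inl rfl⟩
  · rw [(key t).1, hb']
    have h1 : ‖b' t ()‖ ^ 2 = θ ^ 2 := by
      rw [← real_inner_self_eq_norm_sq]
      simp only [b', inner_add_left, inner_add_right, real_inner_smul_left, real_inner_smul_right,
        h00, h01, h10, h11]
      linear_combination θ ^ 2 * Real.sin_sq_add_cos_sq (θ * t)
    simp [h1]
  · rw [veronese_eq hk]
    exact (key t).2

end Manifolds

/-! ### Curvature as a quadratic function on a simplex -/

section Curvature

variable {r : ℕ} {n d : Fin r → ℕ}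

/-- Reduces both bounds to an extremal problem in the squared speeds `q i = ‖b_i'‖²` of a lift. -/
lemma exists_curvature_eq (hr : 0 < r) (hd : ∀ i, 1 ≤ d i) {γ : ℝ → PSTensor n d}
    (hγ : IsUnitSpeedCurve (segreVeronese n d) γ) (t : ℝ) :
    ∃ q : Fin r → ℝ, (∀ i, 0 ≤ q i) ∧ ∑ i, d i * q i = 1 ∧
      curvature (segreVeronese n d) γ t = √(2 * (1 - ∑ i, d i * q i ^ 2)) := by
  have hcomp : CompleteSpace (PSTensor n d) := FiniteDimensional.complete ℝ _
  rw [segreVeronese_eq hr hd] at hγ ⊢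
  have h := isPowerMap_segreVeroneseMap n d
  obtain ⟨a, ha, hx⟩ := hγ.1.2 t
  obtain ⟨g, b, l, -⟩ := h.exists_isLocalLift hd hγ.1 t ha hx
  have h1 := l.norm_deriv_sq h hγ.1
  rw [hγ.2 t, one_pow] at h1
  exact ⟨fun i => ‖deriv b t i‖ ^ 2, fun i => sq_nonneg _, h1.symm, by
    rw [l.curvature_eq h hd hγ.1, ← h1, one_pow]⟩

/-- Cauchy–Schwarz in the form of a nonnegative weighted variance about the mean `1 / D`. -/
lemma one_div_le_sum_mul_sq {D : ℕ} (hD : D = ∑ i, d i) (hD0 : 0 < D) {q : Fin r → ℝ}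
    (hq : ∑ i, d i * q i = 1) : 1 / (D : ℝ) ≤ ∑ i, d i * q i ^ 2 := by
  have hD' : (0 : ℝ) < D := by exact_mod_cast hD0
  have hs : ∑ i, (d i : ℝ) = D := by rw [hD]; push_cast; rfl
  have h1 : 0 ≤ ∑ i, d i * (q i - 1 / D) ^ 2 :=
    Finset.sum_nonneg fun i _ => mul_nonneg (Nat.cast_nonneg _) (sq_nonneg _)
  have h2 : ∑ i, d i * (q i - 1 / D) ^ 2 =
      ∑ i, d i * q i ^ 2 - 2 / D * ∑ i, d i * q i + (1 / D) ^ 2 * ∑ i, (d i : ℝ) := by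
    rw [Finset.mul_sum, Finset.mul_sum, ← Finset.sum_sub_distrib, ← Finset.sum_add_distrib]
    exact Finset.sum_congr rfl fun i _ => by ring
  rw [h2, hq, hs] at h1
  have h3 : (1 / (D : ℝ)) ^ 2 * D = 1 / D := by field_simp
  rw [h3] at h1
  have h4 : 2 / (D : ℝ) * 1 = 1 / D + 1 / D := by ring
  linarith

/-- Minimality of `d l` gives `d l * q i ≤ d i * q i ≤ 1`; the resulting bound on one factor of each
`q i ^ 2` is averaged with weights `d i * q i`. -/
lemma sum_mul_sq_le_one_div (hd : ∀ i, 1 ≤ d i) {l : Fin r} (hl : ∀ i, d l ≤ d i) {q : Fin r → ℝ}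
    (hq0 : ∀ i, 0 ≤ q i) (hq : ∑ i, d i * q i = 1) :
    ∑ i, d i * q i ^ 2 ≤ 1 / (d l : ℝ) := by
  have hdl : (0 : ℝ) < d l := by exact_mod_cast hd l
  have h1 : ∀ i, q i ≤ 1 / d l := by
    intro i
    rw [le_div_iff₀ hdl]
    calc q i * d l ≤ q i * d i := mul_le_mul_of_nonneg_left (by exact_mod_cast hl i) (hq0 i)
      _ = d i * q i := mul_comm _ _
      _ ≤ ∑ i, d i * q i := Finset.single_le_sum
          (f := fun i => (d i : ℝ) * q i)
          (fun j _ => mul_nonneg (Nat.cast_nonneg _) (hq0 j)) (Finset.mem_univ i)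
      _ = 1 := hq
  calc ∑ i, d i * q i ^ 2 ≤ ∑ i, 1 / (d l : ℝ) * (d i * q i) := by
        refine Finset.sum_le_sum fun i _ => ?_
        have := mul_le_mul_of_nonneg_left (h1 i) (mul_nonneg (Nat.cast_nonneg (d i)) (hq0 i))
        linarith
    _ = 1 / (d l : ℝ) := by rw [← Finset.mul_sum, hq, mul_one]

/-- Speed and curvature of products of curves in Veronese manifolds. -/
lemma curvature_tensor (hr : 0 < r) (hd : ∀ i, 1 ≤ d i) {γ : ∀ i, ℝ → Form (n i) (d i)}
    (hγ : ∀ i, IsCurveIn (veronese (n i) (d i)) (γ i)) (t : ℝ) :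
    ‖deriv (fun s => tensor n d fun i => γ i s) t‖ ^ 2 = ∑ i, ‖deriv (γ i) t‖ ^ 2 ∧
    curvature (segreVeronese n d) (fun s => tensor n d fun i => γ i s) t =
      √(2 * ((∑ i, ‖deriv (γ i) t‖ ^ 2) ^ 2 - ∑ i, (‖deriv (γ i) t‖ ^ 2) ^ 2 / d i)) := by
  have h := isPowerMap_segreVeroneseMap n d
  have hc := isCurveIn_tensor hγ
  obtain ⟨g, b, l, hs, -⟩ := exists_isLocalLift_tensor hd hγ t
  rw [segreVeronese_eq hr hd] at hc ⊢
  refine ⟨?_, ?_⟩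
  · rw [l.norm_deriv_sq h hc]
    exact Finset.sum_congr rfl fun i _ => (hs i).symm
  · rw [l.curvature_eq h hd hc]
    -- The power map stretches squared speeds by `d i`, which accounts for the division by `d i`
    -- when the formula is written in terms of `γ i`.
    have e : ∀ i, (‖deriv (γ i) t‖ ^ 2) ^ 2 / (d i : ℝ) = d i * (‖deriv b t i‖ ^ 2) ^ 2 := by
      intro i
      have hdi : (d i : ℝ) ≠ 0 := Nat.cast_ne_zero.2 (Nat.one_le_iff_ne_zero.1 (hd i))
      rw [hs i]
      field_simp
    simp only [e]
    simp only [hs]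

/-- Products of geodesics of Veronese manifolds, of arbitrary constant speeds, are geodesics. -/
lemma deriv_deriv_tensor_mem_orthogonal (hr : 0 < r) (hd : ∀ i, 1 ≤ d i)
    {γ : ∀ i, ℝ → Form (n i) (d i)} (hγ : ∀ i, IsCurveIn (veronese (n i) (d i)) (γ i)) {t : ℝ}
    (hg : ∀ i, deriv (deriv (γ i)) t ∈ (tangentSpace (veronese (n i) (d i)) (γ i t))ᗮ) :
    deriv (deriv fun s => tensor n d fun i => γ i s) t ∈
      (tangentSpace (segreVeronese n d) (tensor n d fun i => γ i t))ᗮ := by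
  have hcomp : CompleteSpace (PSTensor n d) := FiniteDimensional.complete ℝ _
  have hc := isCurveIn_tensor hγ
  obtain ⟨g, b, l, -, hs⟩ := exists_isLocalLift_tensor hd hγ t
  rw [segreVeronese_eq hr hd] at hc ⊢
  exact (l.deriv_deriv_mem_orthogonal_iff (isPowerMap_segreVeroneseMap n d) hd hc).2
    fun i => (hs i).1 (hg i)

lemma isUnitSpeedCurve_tensor (hr : 0 < r) (hd : ∀ i, 1 ≤ d i) {γ : ∀ i, ℝ → Form (n i) (d i)}
    (hγ : ∀ i, IsCurveIn (veronese (n i) (d i)) (γ i))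
    (hs : ∀ t, ∑ i, ‖deriv (γ i) t‖ ^ 2 = 1) :
    IsUnitSpeedCurve (segreVeronese n d) fun s => tensor n d fun i => γ i s := by
  refine ⟨isCurveIn_tensor hγ, fun t => ?_⟩
  have h1 := (curvature_tensor hr hd hγ t).1
  rw [hs] at h1
  exact (sq_eq_sq₀ (norm_nonneg _) zero_le_one).1 (by rw [h1, one_pow])

end Curvature

end SegreVeronese

end
-- The main theorem
open SegreVeronese in
theorem theorem1p2 {r : ℕ} (n d : Fin r → ℕ) (hn : ∀ i, 1 ≤ n i) (hd : ∀ i, 1 ≤ d i)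
    (D : ℕ) (hD : D = ∑ i, d i) (hD2 : 2 ≤ D) :
    -- the maximal curvature
    (IsGreatest (geodesicCurvatures (segreVeronese n d)) (√(2 * ((D : ℝ) - 1) / D)) ∧
      (∀ γ : ℝ → PSTensor n d, IsUnitSpeedCurve (segreVeronese n d) γ →
        ∀ t, curvature (segreVeronese n d) γ t ≤ √(2 * ((D : ℝ) - 1) / D)) ∧
      (∀ γ : ∀ i, ℝ → Form (n i) (d i),
        (∀ i, IsCurveIn (veronese (n i) (d i)) (γ i) ∧
          ∀ t, ‖deriv (γ i) t‖ = √((d i : ℝ) / D)) →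
        IsUnitSpeedCurve (segreVeronese n d) (fun t => tensor n d fun i => γ i t) ∧
        ∀ t, curvature (segreVeronese n d) (fun s => tensor n d fun i => γ i s) t =
            √(2 * ((D : ℝ) - 1) / D)) ∧
      (∃ γ : ∀ i, ℝ → Form (n i) (d i),
        (∀ i, IsCurveIn (veronese (n i) (d i)) (γ i) ∧
          ∀ t, ‖deriv (γ i) t‖ = √((d i : ℝ) / D)) ∧
        IsUnitSpeedGeodesic (segreVeronese n d) fun t => tensor n d fun i => γ i t)) ∧
    -- the minimal curvature
    (∀ l : Fin r, (∀ i, d l ≤ d i) →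
      IsLeast (geodesicCurvatures (segreVeronese n d)) (√(2 * ((d l : ℝ) - 1) / d l)) ∧
      (∀ γ : ℝ → PSTensor n d, IsUnitSpeedCurve (segreVeronese n d) γ →
        ∀ t, √(2 * ((d l : ℝ) - 1) / d l) ≤ curvature (segreVeronese n d) γ t) ∧
      (∀ γ : ∀ i, ℝ → Form (n i) (d i),
        IsUnitSpeedGeodesic (veronese (n l) (d l)) (γ l) →
        (∀ i, i ≠ l → ∃ f ∈ veronese (n i) (d i), ∀ t, γ i t = f) →
        IsUnitSpeedGeodesic (segreVeronese n d) (fun t => tensor n d fun i => γ i t) ∧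
        ∀ t, curvature (segreVeronese n d) (fun s => tensor n d fun i => γ i s) t =
          √(2 * ((d l : ℝ) - 1) / d l)) ∧
      (∃ γ : ∀ i, ℝ → Form (n i) (d i),
        IsUnitSpeedGeodesic (veronese (n l) (d l)) (γ l) ∧
        ∀ i, i ≠ l → ∃ f ∈ veronese (n i) (d i), ∀ t, γ i t = f)) := by
  have hr : 0 < r := by
    rcases Nat.eq_zero_or_pos r with rfl | h
    · simp at hD
      omega
    · exact h
  have hD0 : (0 : ℝ) < D := by exact_mod_cast (by omega : 0 < D)
  have hd0 : ∀ i, (0 : ℝ) < d i := fun i => by exact_mod_cast hd i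
  have hsum : ∑ i, (d i : ℝ) = D := by rw [hD]; push_cast; rfl
  have upper : ∀ γ : ℝ → PSTensor n d, IsUnitSpeedCurve (segreVeronese n d) γ →
      ∀ t, curvature (segreVeronese n d) γ t ≤ √(2 * ((D : ℝ) - 1) / D) := by
    intro γ hγ t
    obtain ⟨q, -, hq, hc⟩ := exists_curvature_eq hr hd hγ t
    rw [hc]
    refine Real.sqrt_le_sqrt ?_
    have h1 := one_div_le_sum_mul_sq hD (by omega) hq
    have h2 : 2 * ((D : ℝ) - 1) / D = 2 * (1 - 1 / D) := by field_simp
    rw [h2]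
    linarith
  have maximal : ∀ γ : ∀ i, ℝ → Form (n i) (d i),
      (∀ i, IsCurveIn (veronese (n i) (d i)) (γ i) ∧
        ∀ t, ‖deriv (γ i) t‖ = √((d i : ℝ) / D)) →
      IsUnitSpeedCurve (segreVeronese n d) (fun t => tensor n d fun i => γ i t) ∧
      ∀ t, curvature (segreVeronese n d) (fun s => tensor n d fun i => γ i s) t =
        √(2 * ((D : ℝ) - 1) / D) := by
    intro γ hγ
    have hsq : ∀ i t, ‖deriv (γ i) t‖ ^ 2 = d i / D := fun i t => by
      rw [(hγ i).2, Real.sq_sqrt (by positivity)]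
    have hs : ∀ t, ∑ i, ‖deriv (γ i) t‖ ^ 2 = 1 := fun t => by
      simp only [hsq, ← Finset.sum_div, hsum, div_self hD0.ne']
    refine ⟨isUnitSpeedCurve_tensor hr hd (fun i => (hγ i).1) hs, fun t => ?_⟩
    rw [(curvature_tensor hr hd (fun i => (hγ i).1) t).2, hs]
    have h1 : ∑ i, (‖deriv (γ i) t‖ ^ 2) ^ 2 / (d i : ℝ) = 1 / D := by
      have h2 : ∀ i, (‖deriv (γ i) t‖ ^ 2) ^ 2 / (d i : ℝ) = d i / D ^ 2 := fun i => by
        have := (hd0 i).ne'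
        rw [hsq]
        field_simp
      simp only [h2]
      rw [← Finset.sum_div, hsum]
      field_simp
    rw [h1]
    congr 1
    field_simp
  have exists_maximal : ∃ γ : ∀ i, ℝ → Form (n i) (d i),
      (∀ i, IsCurveIn (veronese (n i) (d i)) (γ i) ∧
        ∀ t, ‖deriv (γ i) t‖ = √((d i : ℝ) / D)) ∧
      IsUnitSpeedGeodesic (segreVeronese n d) fun t => tensor n d fun i => γ i t := by
    -- Angular speed `√(1 / D)` in every factor makes all `q i` equal to `1 / D`, the equality case
    -- of the variance bound.
    choose γ h1 h2 h3 using fun i => exists_circular_curve (hn i) (hd i) (√(1 / (D : ℝ)))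
    have h4 : ∀ i, IsCurveIn (veronese (n i) (d i)) (γ i) ∧
        ∀ t, ‖deriv (γ i) t‖ = √((d i : ℝ) / D) := by
      refine fun i => ⟨h1 i, fun t => ?_⟩
      rw [← Real.sqrt_sq (norm_nonneg (deriv (γ i) t)), h2, Real.sq_sqrt (by positivity),
        mul_one_div]
    exact ⟨γ, h4, (maximal γ h4).1,
      fun t => deriv_deriv_tensor_mem_orthogonal hr hd h1 fun i => h3 i t⟩
  refine ⟨⟨⟨?_, ?_⟩, upper, maximal, exists_maximal⟩, fun l hl => ?_⟩
  · obtain ⟨γ, h1, h2⟩ := exists_maximal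
    exact ⟨_, h2, 0, (maximal γ h1).2 0⟩
  · rintro _ ⟨γ, hγ, t, rfl⟩
    exact upper γ hγ.1 t
  have lower : ∀ γ : ℝ → PSTensor n d, IsUnitSpeedCurve (segreVeronese n d) γ →
      ∀ t, √(2 * ((d l : ℝ) - 1) / d l) ≤ curvature (segreVeronese n d) γ t := by
    intro γ hγ t
    obtain ⟨q, hq0, hq, hc⟩ := exists_curvature_eq hr hd hγ t
    rw [hc]
    refine Real.sqrt_le_sqrt ?_
    have h1 := sum_mul_sq_le_one_div hd hl hq0 hq
    have h2 : 2 * ((d l : ℝ) - 1) / d l = 2 * (1 - 1 / d l) := by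
      have := (hd0 l).ne'
      field_simp
    rw [h2]
    linarith
  have minimal : ∀ γ : ∀ i, ℝ → Form (n i) (d i),
      IsUnitSpeedGeodesic (veronese (n l) (d l)) (γ l) →
      (∀ i, i ≠ l → ∃ f ∈ veronese (n i) (d i), ∀ t, γ i t = f) →
      IsUnitSpeedGeodesic (segreVeronese n d) (fun t => tensor n d fun i => γ i t) ∧
      ∀ t, curvature (segreVeronese n d) (fun s => tensor n d fun i => γ i s) t =
        √(2 * ((d l : ℝ) - 1) / d l) := by
    intro γ hγ hc
    have hconst : ∀ i, i ≠ l → deriv (γ i) = fun _ => 0 := by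
      intro i hi
      obtain ⟨f, -, hf⟩ := hc i hi
      rw [funext hf]
      exact deriv_const' f
    have hcurve : ∀ i, IsCurveIn (veronese (n i) (d i)) (γ i) := by
      intro i
      by_cases hi : i = l
      · rw [hi]
        exact hγ.1.1
      · obtain ⟨f, hf, hfc⟩ := hc i hi
        rw [funext hfc]
        exact ⟨contDiff_const, fun _ => hf⟩
    have hs : ∀ t, ∑ i, ‖deriv (γ i) t‖ ^ 2 = 1 := fun t => by
      rw [Finset.sum_eq_single l (fun i _ hi => by simp [hconst i hi]) (by simp), hγ.1.2 t,
        one_pow]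
    refine ⟨⟨isUnitSpeedCurve_tensor hr hd hcurve hs, fun t =>
      deriv_deriv_tensor_mem_orthogonal hr hd hcurve fun i => ?_⟩, fun t => ?_⟩
    · by_cases hi : i = l
      · rw [hi]
        exact hγ.2 t
      · rw [hconst i hi, deriv_const]
        exact Submodule.zero_mem _
    · rw [(curvature_tensor hr hd hcurve t).2, hs,
        Finset.sum_eq_single l (fun i _ hi => by simp [hconst i hi]) (by simp), hγ.1.2 t]
      congr 1
      have := (hd0 l).ne'
      field_simp
  have exists_minimal : ∃ γ : ∀ i, ℝ → Form (n i) (d i),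
      IsUnitSpeedGeodesic (veronese (n l) (d l)) (γ l) ∧
      ∀ i, i ≠ l → ∃ f ∈ veronese (n i) (d i), ∀ t, γ i t = f := by
    -- Angular speed `√(1 / d i)` gives unit speed in the Veronese manifold; every factor except the
    -- one at `l` is then frozen at time `0`.
    choose γ h1 h2 h3 using fun i => exists_circular_curve (hn i) (hd i) (√(1 / (d i : ℝ)))
    refine ⟨fun i t => if i = l then γ i t else γ i 0, ?_, fun i hi => ⟨γ i 0, (h1 i).2 0, ?_⟩⟩
    · simp only [if_true]
      refine ⟨⟨h1 l, fun t => ?_⟩, h3 l⟩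
      have := h2 l t
      rw [Real.sq_sqrt (by positivity), mul_one_div, div_self (hd0 l).ne'] at this
      exact (sq_eq_sq₀ (norm_nonneg _) zero_le_one).1 (by rw [this, one_pow])
    · exact fun t => if_neg hi
  refine ⟨⟨?_, ?_⟩, lower, minimal, exists_minimal⟩
  · obtain ⟨γ, h1, h2⟩ := exists_minimal
    exact ⟨_, (minimal γ h1 h2).1, 0, (minimal γ h1 h2).2 0⟩
  · rintro _ ⟨γ, hγ, t, rfl⟩
    exact lower γ hγ.1 t
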